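/- Let $\mathbb{D}$ be the open unit disc, $\mathbb{T}$ the unit circle and $m$ the normalized Lebesgue measure on $\mathbb{T}$. Let $b$ be an analytic function on $\mathbb{D}$ with $|b|\le 1$, and let $a$ be its Pythagorean mate, that is, an outer function on $\mathbb{D}$ with $a(0)>0$ and $$|a|^2+|b|^2=1\qquad m\text{-a.e. on }\mathbb{T}$$ (in terms of radial boundary values). Assume that $(b,a)$ is a corona pair, i.e. $$\inf_{z\in\mathbb{D}}\bigl(|a(z)|^2+|b(z)|^2\bigr)>0 .$$ Let $\mathcal{H}(b)$ be the de Branges--Rovnyak space, i.e. the reproducing kernel Hilbert space on $\mathbb{D}$ with kernel $$k^b_\lambda(z)=\frac{1-b(z)\overline{b(\lambda)}}{1-z\overline{\lambda}},\qquad z,\lambda\in\mathbb{D}.$$ Let $\mu$ be a finite positive Borel measure on $\mathbb{T}$, and let $\mathcal{D}_\mu$ be the harmonically weighted Dirichlet space, i.e. the set of all $f$ in the Hardy space $H^2$ of the disc with $$\frac1\pi\int_{\mathbb{D}}|f'(z)|^2\int_{\mathbb{T}}\frac{1-|z|^2}{|z-\zeta|^2}\,d\mu(\zeta)\,dA(z)<\infty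 ,$$ where $A$ is two-dimensional Lebesgue measure. If $\mathcal{H}(b)=\mathcal{D}_\mu$ as sets of functions on $\mathbb{D}$, then $$\operatorname{supp}(\mu)=\overline{\{\lambda\in\mathbb{T}:\ \lim_{r\to1^-}a(r\lambda)=0\}} .$$ -/

import Mathlib

open Complex Metric Set Filter Topology MeasureTheory
open scoped ComplexConjugate ENNReal Complex.UnitDisc InnerProductSpace

noncomputable section

/-! Functions on the open unit disc are represented by functions `ℂ → ℂ` of which only the
values on `ball 0 1` matter. -/

/-- The Borel sigma-algebra of the unit circle. -/
instance Circle.instMeasurableSpaceBorel : MeasurableSpace Circle := borel Circle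

instance Circle.instBorelSpaceBorel : BorelSpace Circle := ⟨rfl⟩

/-- `b` lies in the closed unit ball of `H^∞`. -/
structure IsSchur (b : ℂ → ℂ) : Prop where
  diff : DifferentiableOn ℂ b (ball 0 1)
  bound : ∀ z ∈ ball (0 : ℂ) 1, ‖b z‖ ≤ 1

/-! ### De Branges--Rovnyak spaces -/

/-- The Cauchy--Szegő kernel function `ζ ↦ 1 / (1 - conj w * ζ)`. -/
def szegoFun (w ζ : ℂ) : ℂ := 1 / (1 - conj w * ζ)

/-- The de Branges--Rovnyak kernel `k_w(z) = (1 - b(z) conj (b(w))) / (1 - z conj w)`. -/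
def dbrKernel (b : ℂ → ℂ) (z w : ℂ) : ℂ :=
  (1 - b z * conj (b w)) / (1 - z * conj w)

/-- The de Branges--Rovnyak kernel as an operator-valued matrix indexed by the disc; the
`(z, w)` entry is multiplication by `k_w(z)`. -/
def dbrMatrix (b : ℂ → ℂ) : Matrix 𝔻 𝔻 (ℂ →L[ℂ] ℂ) :=
  Matrix.of fun z w => dbrKernel b z w • ContinuousLinearMap.id ℂ ℂ

lemma one_sub_conj_mul_ne {w ζ : ℂ} (hw : ‖w‖ < 1) (hζ : ‖ζ‖ ≤ 1) : 1 - conj w * ζ ≠ 0 := by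
  intro h
  have h1 : conj w * ζ = 1 := (sub_eq_zero.mp h).symm
  have h2 : ‖w‖ * ‖ζ‖ = 1 := by
    have := congrArg norm h1
    simpa using this
  nlinarith [norm_nonneg w, norm_nonneg ζ]

lemma diffContOnCl_szegoFun {w : ℂ} (hw : ‖w‖ < 1) : DiffContOnCl ℂ (szegoFun w) (ball 0 1) := by
  refine DifferentiableOn.diffContOnCl ?_
  intro z hz
  rw [closure_ball (0 : ℂ) one_ne_zero, mem_closedBall_zero_iff] at hz
  have := one_sub_conj_mul_ne hw hz
  unfold szegoFun
  apply DifferentiableAt.differentiableWithinAt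
  fun_prop (disch := assumption)

lemma circleAverage_mul_conj_szegoFun {g : ℂ → ℂ} (hg : DiffContOnCl ℂ g (ball 0 1))
    {w : ℂ} (hw : ‖w‖ < 1) :
    Real.circleAverage (fun ζ => g ζ * conj (szegoFun w ζ)) 0 1 = g w := by
  have h := DiffContOnCl.circleAverage_smul_div (c := 0) (R := 1) (f := g) (w := w)
    (by simpa using hg) (by simpa using hw)
  rw [← h]
  apply Real.circleAverage_congr_sphere
  intro ζ hζ
  have hn : ‖ζ‖ = 1 := by simpa using hζ
  have h0 : ζ ≠ 0 := by
    rintro rfl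
    simp at hn
  have hc : conj ζ = ζ⁻¹ := by
    rw [Complex.inv_def, Complex.normSq_eq_norm_sq, hn]
    simp
  have hne : ζ - w ≠ 0 := by
    intro h'
    rw [sub_eq_zero] at h'
    rw [h'] at hn
    linarith
  simp only [szegoFun, map_div₀, map_sub, map_one, map_mul, Complex.conj_conj, hc, smul_eq_mul,
    sub_zero]
  have : 1 - w * ζ⁻¹ ≠ 0 := by
    have : 1 - w * ζ⁻¹ = (ζ - w) * ζ⁻¹ := by field_simp
    rw [this]
    exact mul_ne_zero hne (inv_ne_zero h0)
  field_simp

lemma circleIntegrable_mul_conj {g k : ℂ → ℂ} (hg : DiffContOnCl ℂ g (ball 0 1))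
    (hk : DiffContOnCl ℂ k (ball 0 1)) :
    CircleIntegrable (fun ζ => g ζ * conj (k ζ)) 0 1 := by
  have hs : sphere (0 : ℂ) |1| ⊆ closure (ball 0 1) := by
    rw [closure_ball (0 : ℂ) one_ne_zero, abs_one]
    exact sphere_subset_closedBall
  apply ContinuousOn.circleIntegrable'
  exact (hg.continuousOn.mono hs).mul
    (Complex.continuous_conj.comp_continuousOn (hk.continuousOn.mono hs))

lemma circleAverage_mul_conj_sum {g : ℂ → ℂ} (hg : DiffContOnCl ℂ g (ball 0 1))
    (s : Finset 𝔻) (c : 𝔻 → ℂ) :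
    Real.circleAverage (fun ζ => g ζ * conj (∑ w ∈ s, c w * szegoFun w ζ)) 0 1
      = ∑ w ∈ s, conj (c w) * g w := by
  have h : (fun ζ => g ζ * conj (∑ w ∈ s, c w * szegoFun w ζ))
      = fun ζ => ∑ w ∈ s, conj (c w) • (g ζ * conj (szegoFun w ζ)) := by
    funext ζ
    simp only [map_sum, map_mul, Finset.mul_sum, smul_eq_mul]
    exact Finset.sum_congr rfl fun _ _ => by ring
  rw [h, Real.circleAverage_fun_sum]
  · refine Finset.sum_congr rfl fun w _ => ?_
    rw [Real.circleAverage_fun_smul, circleAverage_mul_conj_szegoFun hg w.norm_lt_one, smul_eq_mul]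
  · intro w _
    exact (circleIntegrable_mul_conj hg (diffContOnCl_szegoFun w.norm_lt_one)).const_smul

lemma diffContOnCl_sum (s : Finset 𝔻) (c : 𝔻 → ℂ) :
    DiffContOnCl ℂ (fun ζ => ∑ w ∈ s, c w * szegoFun w ζ) (ball 0 1) := by
  induction s using Finset.cons_induction with
  | empty => simpa using diffContOnCl_const
  | cons a s ha ih =>
    simp only [Finset.sum_cons]
    exact ((diffContOnCl_szegoFun a.norm_lt_one).const_smul (c a)).add ih

/-- Positivity of the kernel when `b` is continuous up to the boundary. -/
lemma dbrKernel_sum_nonneg_of_cl {b : ℂ → ℂ} (hb : DiffContOnCl ℂ b (ball 0 1))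
    (hb1 : ∀ z ∈ closedBall (0 : ℂ) 1, ‖b z‖ ≤ 1) (s : Finset 𝔻) (v : 𝔻 → ℂ) :
    0 ≤ (∑ z ∈ s, ∑ w ∈ s, conj (v z) * v w * dbrKernel b z w).re := by
  set h : ℂ → ℂ := fun ζ => ∑ w ∈ s, v w * szegoFun w ζ with hh
  set T : ℂ → ℂ := fun ζ => ∑ w ∈ s, (v w * conj (b w)) * szegoFun w ζ with hT
  have dh : DiffContOnCl ℂ h (ball 0 1) := diffContOnCl_sum s v
  have dT : DiffContOnCl ℂ T (ball 0 1) := diffContOnCl_sum s _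
  have dg : DiffContOnCl ℂ (fun ζ => h ζ - 2 * (b ζ * T ζ)) (ball 0 1) :=
    dh.sub ((hb.smul dT).const_smul (2 : ℂ))
  have e1 := circleAverage_mul_conj_sum dg s v
  have e2 := circleAverage_mul_conj_sum dT s (fun w => v w * conj (b w))
  have i1 := circleIntegrable_mul_conj dg dh
  have i2 := circleIntegrable_mul_conj dT dT
  have e3 := Real.circleAverage_fun_add i1 i2
  have key : ∑ z ∈ s, ∑ w ∈ s, conj (v z) * v w * dbrKernel b z w =
      Real.circleAverage (fun ζ => (h ζ - 2 * (b ζ * T ζ)) * conj (h ζ) + T ζ * conj (T ζ)) 0 1 := by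
    rw [e3]
    change _ = Real.circleAverage
      (fun ζ => (h ζ - 2 * (b ζ * T ζ)) * conj (∑ w ∈ s, v w * szegoFun w ζ)) 0 1 +
      Real.circleAverage
      (fun ζ => T ζ * conj (∑ w ∈ s, (v w * conj (b w)) * szegoFun w ζ)) 0 1
    rw [e1, e2, ← Finset.sum_add_distrib]
    refine Finset.sum_congr rfl fun z _ => ?_
    have : conj (v z) * (h z - 2 * (b z * T z)) + conj (v z * conj (b z)) * T z
        = conj (v z) * h z - conj (v z) * b z * T z := by
      simp only [map_mul, Complex.conj_conj]
      ring
    rw [this, hh, hT]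
    simp only [Finset.mul_sum]
    rw [← Finset.sum_sub_distrib]
    refine Finset.sum_congr rfl fun w _ => ?_
    simp only [dbrKernel, szegoFun, mul_comm (conj (w : ℂ))]
    ring
  rw [key]
  have i3 : CircleIntegrable
      (fun ζ => (h ζ - 2 * (b ζ * T ζ)) * conj (h ζ) + T ζ * conj (T ζ)) 0 1 := i1.add i2
  have e4 := Complex.reCLM.circleAverage_comp_comm i3
  change _ = Complex.re _ at e4
  rw [← e4]
  apply Real.circleAverage_nonneg_of_nonneg
  intro ζ hζ
  have hn : ‖ζ‖ = 1 := by simpa using hζ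
  have hbz := hb1 ζ (by simp [hn])
  have hid : ((h ζ - 2 * (b ζ * T ζ)) * conj (h ζ) + T ζ * conj (T ζ)).re
      = normSq (conj (b ζ) * h ζ - T ζ) + (1 - normSq (b ζ)) * normSq (h ζ) := by
    simp only [normSq_apply, add_re, mul_re, sub_re, sub_im, mul_im, conj_re, conj_im, re_ofNat,
      im_ofNat]
    ring
  change 0 ≤ ((h ζ - 2 * (b ζ * T ζ)) * conj (h ζ) + T ζ * conj (T ζ)).re
  rw [hid]
  have : normSq (b ζ) ≤ 1 := by
    rw [normSq_eq_norm_sq]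
    exact pow_le_one₀ (norm_nonneg _) hbz
  have := mul_nonneg (sub_nonneg.mpr this) (normSq_nonneg (h ζ))
  have := normSq_nonneg (conj (b ζ) * h ζ - T ζ)
  linarith

lemma dbrKernel_sum_nonneg {b : ℂ → ℂ} (hb : IsSchur b) (s : Finset 𝔻) (v : 𝔻 → ℂ) :
    0 ≤ (∑ z ∈ s, ∑ w ∈ s, conj (v z) * v w * dbrKernel b z w).re := by
  have hr : ∀ r ∈ Ioo (0 : ℝ) 1, 0 ≤ (∑ z ∈ s, ∑ w ∈ s,
      conj (v z) * v w * dbrKernel (fun ζ => b (r * ζ)) z w).re := by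
    intro r hr
    have hmaps : ∀ z ∈ closedBall (0 : ℂ) 1, (r : ℂ) * z ∈ ball (0 : ℂ) 1 := by
      intro z hz
      rw [mem_closedBall_zero_iff] at hz
      rw [mem_ball_zero_iff, norm_mul, Complex.norm_real, Real.norm_of_nonneg hr.1.le]
      nlinarith [hr.1, hr.2, norm_nonneg z]
    apply dbrKernel_sum_nonneg_of_cl
    · apply DifferentiableOn.diffContOnCl
      rw [closure_ball (0 : ℂ) one_ne_zero]
      exact hb.diff.comp (by fun_prop) hmaps
    · exact fun z hz => hb.bound _ (hmaps z hz)
  have hb0 : ∀ z : 𝔻, Tendsto (fun r : ℝ => b (r * z)) (𝓝[<] 1) (𝓝 (b z)) := by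
    intro z
    have hc : ContinuousAt b z :=
      (hb.diff.differentiableAt (isOpen_ball.mem_nhds (by simpa using z.norm_lt_one))).continuousAt
    have h2 : Tendsto (fun r : ℝ => (r : ℂ) * z) (𝓝[<] 1) (𝓝 (z : ℂ)) := by
      have : Continuous fun r : ℝ => (r : ℂ) * (z : ℂ) := by fun_prop
      have := this.tendsto 1
      simp only [ofReal_one, one_mul] at this
      exact this.mono_left nhdsWithin_le_nhds
    exact hc.tendsto.comp h2
  have hlim : Tendsto (fun r : ℝ => (∑ z ∈ s, ∑ w ∈ s,
      conj (v z) * v w * dbrKernel (fun ζ => b (r * ζ)) z w).re) (𝓝[<] 1)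
      (𝓝 (∑ z ∈ s, ∑ w ∈ s, conj (v z) * v w * dbrKernel b z w).re) := by
    refine (Complex.continuous_re.tendsto _).comp ?_
    refine tendsto_finsetSum _ fun z _ => tendsto_finsetSum _ fun w _ => ?_
    refine Tendsto.const_mul _ ?_
    unfold dbrKernel
    refine Tendsto.div_const ?_ _
    exact tendsto_const_nhds.sub
      ((hb0 z).mul ((Complex.continuous_conj.tendsto _).comp (hb0 w)))
  refine ge_of_tendsto hlim ?_
  filter_upwards [Ioo_mem_nhdsLT (zero_lt_one (α := ℝ))] with r h using hr r h

lemma posSemidef_dbrMatrix {b : ℂ → ℂ} (hb : IsSchur b) : (dbrMatrix b).PosSemidef := by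
  have e : (dbrMatrix b).PosSemidef ↔ _ := RKHS.posSemidef_tfae.out 0 2
  refine e.mpr ⟨?_, ?_⟩
  · ext z w
    have hs : star (ContinuousLinearMap.id ℂ ℂ) = ContinuousLinearMap.id ℂ ℂ :=
      star_one (ℂ →L[ℂ] ℂ)
    simp [dbrMatrix, dbrKernel, Matrix.conjTranspose_apply, hs, mul_comm]
  · intro vv
    have h := dbrKernel_sum_nonneg hb vv.support vv
    rw [← Complex.conj_re] at h
    convert h using 2
    simp only [Finsupp.sum, map_sum, Complex.re_sum]
    rw [Finset.sum_comm]
    refine Finset.sum_congr rfl fun z _ => Finset.sum_congr rfl fun w _ => ?_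
    change Complex.re _ = Complex.re _
    congr 1
    simp [dbrMatrix]
    ring

/-- The de Branges--Rovnyak space `H(b)`, as a set of functions: the functions on the disc that
belong to the reproducing kernel Hilbert space with kernel
`(1 - b(z) conj (b(w))) / (1 - z conj w)`. -/
def deBrangesRovnyak (b : ℂ → ℂ) (hb : IsSchur b) : Set (ℂ → ℂ) :=
  haveI : Fact (dbrMatrix b).PosSemidef := ⟨posSemidef_dbrMatrix hb⟩
  {f | ∃ g : RKHS.OfKernel (dbrMatrix b), ∀ z : 𝔻, f z = g z}

/-! ### Harmonically weighted Dirichlet spaces -/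

/-- The Hardy space `H²` of the disc. -/
def hardyTwo : Set (ℂ → ℂ) :=
  {f | DifferentiableOn ℂ f (ball 0 1) ∧
    ∃ C : ℝ, ∀ r ∈ Ioo (0 : ℝ) 1, Real.circleAverage (fun z => ‖f z‖ ^ 2) 0 r ≤ C}

/-- The Poisson integral of a measure on the circle. -/
def poissonIntegral (μ : Measure Circle) (z : ℂ) : ℝ :=
  ∫ ζ : Circle, (1 - ‖z‖ ^ 2) / ‖z - ζ‖ ^ 2 ∂μ

/-- The harmonically weighted Dirichlet integral
`(1 / π) ∫ |f'|² P_μ dA` over the disc, with values in `[0, ∞]`. -/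
def dirichletIntegral (μ : Measure Circle) (f : ℂ → ℂ) : ℝ≥0∞ :=
  ENNReal.ofReal (1 / Real.pi) *
    ∫⁻ z in ball (0 : ℂ) 1, ENNReal.ofReal (‖deriv f z‖ ^ 2 * poissonIntegral μ z)

/-- The harmonically weighted Dirichlet space `D_μ`, as a set of functions. -/
def harmonicDirichlet (μ : Measure Circle) : Set (ℂ → ℂ) :=
  {f | f ∈ hardyTwo ∧ dirichletIntegral μ f < ∞}

/-! ### Pythagorean pairs and corona pairs -/

/-- `f` has the radial limit `v` at the point `ζ` of the circle. -/
def HasRadialLimit (f : ℂ → ℂ) (ζ : Circle) (v : ℂ) : Prop :=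
  Tendsto (fun r : ℝ => f (r * ζ)) (𝓝[<] 1) (𝓝 v)

/-- `f` is an outer function: with `f` denoting also the radial boundary values and `m` the
normalized Lebesgue measure of the circle, `log |f|` is `m`-integrable and
`f(z) = c * exp (∫ (ζ + z) / (ζ - z) * log |f(ζ)| dm(ζ))` on the disc, with `|c| = 1`.
Here `k` stands for `log |f|` on the circle. -/
def IsOuter (f : ℂ → ℂ) : Prop :=
  ∃ (c : ℂ) (k : ℂ → ℝ), ‖c‖ = 1 ∧ CircleIntegrable k 0 1 ∧
    (∀ᵐ t : ℝ, ∃ v : ℂ, HasRadialLimit f (Circle.exp t) v ∧ ‖v‖ = Real.exp (k (Circle.exp t))) ∧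
    ∀ z ∈ ball (0 : ℂ) 1,
      f z = c * exp (Real.circleAverage (fun ζ => (ζ + z) / (ζ - z) * (k ζ : ℂ)) 0 1)

/-- `a` is the Pythagorean mate of the function `b` of the closed unit ball of `H^∞`: the outer
function with `a(0) > 0` and `|a|² + |b|² = 1` almost everywhere on the circle. -/
structure IsPythagoreanPair (b a : ℂ → ℂ) : Prop where
  schur : IsSchur b
  outer : IsOuter a
  re_pos : 0 < (a 0).re
  im_zero : (a 0).im = 0
  sq_add_sq : ∀ᵐ t : ℝ, ∃ α β : ℂ, HasRadialLimit a (Circle.exp t) α ∧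
    HasRadialLimit b (Circle.exp t) β ∧ ‖α‖ ^ 2 + ‖β‖ ^ 2 = 1

/-- A corona pair: a Pythagorean pair with `inf (|a|² + |b|²) > 0` over the disc. -/
structure IsCoronaPair (b a : ℂ → ℂ) : Prop extends IsPythagoreanPair b a where
  corona : ∃ δ : ℝ, 0 < δ ∧ ∀ z ∈ ball (0 : ℂ) 1, δ ≤ ‖a z‖ ^ 2 + ‖b z‖ ^ 2

/-- The boundary zero set: the points of the circle at which `a` has radial limit `0`. -/
def boundaryZeroSet (a : ℂ → ℂ) : Set Circle :=
  {ζ | HasRadialLimit a ζ 0}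

end

/-!
Equality of the two spaces as sets makes their norms comparable, and the Cauchy kernels
`k_w(z) = 1 / (1 - conj w z)` are the functions to compare them on. Write
`V(w) = ∫ |w - ζ|⁻² dμ(ζ)` for the quadratic potential of `μ` (`quadraticPotential`).

Every Cauchy kernel lies in `D_μ`, hence in `H(b)`, and its `H(b)`-norm satisfies
`‖k_w‖² ≤ (1 + |b(w) / a(w)|²) / (1 - |w|²)` (`norm_sq_le_of_eq_szegoFun`). This expresses that the
Toeplitz row `[T_b̄, T_ā]` is contractive, which holds since `|a|² + |b|² = 1` on the circle. On the
other side the Dirichlet integral of `k_w` is at least a constant times `V(w) / (1 - |w|)`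
(`quadraticPotential_le_dirichletIntegral`), and the embedding of `H(b)` in `D_μ` is bounded by
Baire's theorem (`exists_dirichletIntegral_le`). If `a` does not tend to `0` along the radius of a
point `ξ` of the circle, then `V` is bounded along a sequence tending to `ξ` radially, and
`V(ξ) < ∞` by Fatou's lemma (`quadraticPotential_lt_top`). A finite potential on an open set forces
`μ` to vanish there (`measure_eq_zero_of_quadraticPotential_lt_top`), because the arcs `I` that
meet `{V ≤ n}` then have measure at most `n |I|²`. Hence the support lies in the closure of the
boundary zero set.

Conversely, let `ξ` be off the support of `μ`. For `w` near `ξ` the functions `√(1 - |w|) k_w` are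
bounded in `D_μ` (`exists_dirichletIntegral_szegoFun_le`), hence in `H(b)` by the closed graph
theorem, applied to the synthesis map `ℓ¹ → H(b)` of a sequence of them
(`UniformlyDirichlet.exists_norm_le`). Since evaluation at `w` has squared norm
`(1 - |b(w)|²) / (1 - |w|²)` on `H(b)`, the modulus `|b|` stays away from `1` near `ξ`
(`exists_norm_sq_le_of_notMem_support`). So `|a|` is bounded below almost everywhere on an arc about
`ξ`, and the Poisson formula for `log |a|` keeps the outer function `a` away from `0` on the radius
of `ξ` (`BoundaryData.not_hasRadialLimit_zero`). This half gives the other inclusion, as the support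
is closed.
-/

noncomputable section

/-! ### Two integrals over the plane -/

/-- Integration in polar coordinates of a radial function. -/
lemma lintegral_fun_norm_complex {φ : ℝ → ℝ≥0∞} (hφ : Measurable φ) :
    ∫⁻ z : ℂ, φ ‖z‖ =
      ENNReal.ofReal (2 * Real.pi) * ∫⁻ r in Ioi (0 : ℝ), ENNReal.ofReal r * φ r := by
  rw [← Complex.lintegral_comp_polarCoord_symm]
  have h1 : ∀ p ∈ polarCoord.target,
      ENNReal.ofReal p.1 • φ ‖Complex.polarCoord.symm p‖ =
        (fun p : ℝ × ℝ => (ENNReal.ofReal p.1 * φ p.1) * 1) p := by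
    intro p hp
    have : 0 < p.1 := hp.1
    simp [abs_of_pos this]
  rw [setLIntegral_congr_fun polarCoord.open_target.measurableSet h1]
  rw [show polarCoord.target = Ioi (0 : ℝ) ×ˢ Ioo (-Real.pi) Real.pi from rfl,
    Measure.volume_eq_prod, ← Measure.prod_restrict,
    lintegral_prod_mul (f := fun r => ENNReal.ofReal r * φ r) (g := fun _ => 1)
      (by fun_prop) (by fun_prop)]
  simp only [lintegral_const, one_mul, Measure.restrict_apply MeasurableSet.univ, univ_inter,
    Real.volume_Ioo]
  rw [mul_comm]
  congr 2
  ring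

lemma setLIntegral_inv_norm_pow_three_le (w : ℂ) {δ : ℝ} (hδ : 0 < δ) :
    ∫⁻ z in {z : ℂ | δ ≤ ‖z - w‖}, ENNReal.ofReal (1 / ‖z - w‖ ^ 3)
      ≤ ENNReal.ofReal (2 * Real.pi / δ) := by
  have hm : MeasurableSet {z : ℂ | δ ≤ ‖z - w‖} := measurableSet_le (by fun_prop) (by fun_prop)
  set φ : ℝ → ℝ≥0∞ := (Ici δ).indicator fun r => ENNReal.ofReal (1 / r ^ 3) with hφ
  have hφm : Measurable φ := by
    apply Measurable.indicator _ measurableSet_Ici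
    fun_prop
  rw [← lintegral_indicator hm]
  have e : ∀ z : ℂ, {z : ℂ | δ ≤ ‖z - w‖}.indicator
      (fun z => ENNReal.ofReal (1 / ‖z - w‖ ^ 3)) z = φ ‖z - w‖ := fun z => rfl
  simp_rw [e]
  rw [lintegral_sub_right_eq_self (fun z : ℂ => φ ‖z‖) w, lintegral_fun_norm_complex hφm]
  have h2 : ∫⁻ r in Ioi (0 : ℝ), ENNReal.ofReal r * φ r
      = ∫⁻ r in Ioi δ, ENNReal.ofReal (r ^ (-2 : ℝ)) := by
    rw [setLIntegral_congr (Ioi_ae_eq_Ici (a := δ)), ← lintegral_indicator measurableSet_Ioi,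
      ← lintegral_indicator measurableSet_Ici]
    congr 1
    funext r
    by_cases hr : δ ≤ r
    · have h0 : 0 < r := hδ.trans_le hr
      rw [indicator_of_mem (show r ∈ Ioi (0 : ℝ) from h0), indicator_of_mem (show r ∈ Ici δ from hr),
        hφ, indicator_of_mem (show r ∈ Ici δ from hr), ← ENNReal.ofReal_mul h0.le]
      congr 1
      rw [Real.rpow_neg h0.le]
      norm_cast
      field_simp
    · rw [indicator_of_notMem (show r ∉ Ici δ from hr), hφ]
      by_cases h0 : r ∈ Ioi (0 : ℝ)
      · rw [indicator_of_mem h0, indicator_of_notMem (show r ∉ Ici δ from hr), mul_zero]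
      · rw [indicator_of_notMem h0]
  rw [h2, ← ofReal_integral_eq_lintegral_ofReal
    (integrableOn_Ioi_rpow_of_lt (by norm_num) hδ), integral_Ioi_rpow_of_lt (by norm_num) hδ,
    ← ENNReal.ofReal_mul (by positivity)]
  · apply le_of_eq
    congr 1
    have : (-2 : ℝ) + 1 = -1 := by norm_num
    rw [this, Real.rpow_neg hδ.le, Real.rpow_one]
    field_simp
  · filter_upwards [self_mem_ae_restrict measurableSet_Ioi] with r hr
    have : (0 : ℝ) < r := hδ.trans hr
    positivity

lemma setLIntegral_inv_norm_le {w : ℂ} (hw : ‖w‖ ≤ 1) :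
    ∫⁻ z in ball (0 : ℂ) 1, ENNReal.ofReal (1 / ‖z - w‖) ≤ ENNReal.ofReal (4 * Real.pi) := by
  set φ : ℝ → ℝ≥0∞ := (Iio 2).indicator fun r => ENNReal.ofReal (1 / r) with hφ
  have hφm : Measurable φ := by
    apply Measurable.indicator _ measurableSet_Iio
    fun_prop
  rw [← lintegral_indicator measurableSet_ball]
  calc _ ≤ ∫⁻ z : ℂ, φ ‖z - w‖ := by
        apply lintegral_mono
        intro z
        by_cases hz : z ∈ ball (0 : ℂ) 1
        · have h1 : ‖z‖ < 1 := by simpa using hz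
          have h2 : ‖z - w‖ ∈ Iio (2 : ℝ) := by
            have := norm_sub_le z w
            simp only [mem_Iio]; linarith
          simp only [hφ]
          rw [indicator_of_mem hz, indicator_of_mem h2]
        · rw [indicator_of_notMem hz]; exact zero_le
    _ = ∫⁻ z : ℂ, φ ‖z‖ := lintegral_sub_right_eq_self (fun z : ℂ => φ ‖z‖) w
    _ = ENNReal.ofReal (2 * Real.pi) * ∫⁻ r in Ioi (0 : ℝ), ENNReal.ofReal r * φ r :=
        lintegral_fun_norm_complex hφm
    _ ≤ ENNReal.ofReal (2 * Real.pi) * ∫⁻ r in Ioi (0 : ℝ), (Iio (2 : ℝ)).indicator 1 r := by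
        gcongr ENNReal.ofReal (2 * Real.pi) * ?_
        apply setLIntegral_mono' measurableSet_Ioi
        intro r hr
        have h0 : (0 : ℝ) < r := hr
        by_cases h2 : r ∈ Iio (2 : ℝ)
        · simp only [hφ]
          rw [indicator_of_mem h2, indicator_of_mem h2, ← ENNReal.ofReal_mul h0.le]
          simp [h0.ne']
        · simp only [hφ]
          rw [indicator_of_notMem h2]; simp
    _ = _ := by
        rw [lintegral_indicator_one measurableSet_Iio, Measure.restrict_apply measurableSet_Iio,
          inter_comm, Ioi_inter_Iio, Real.volume_Ioo, ← ENNReal.ofReal_mul (by positivity)]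
        congr 1
        ring

/-! ### Dirichlet integrals of Cauchy kernels -/

lemma one_sub_norm_le_norm_sub_circle (z : ℂ) (ζ : Circle) : 1 - ‖z‖ ≤ ‖z - ζ‖ := by
  have h := norm_sub_norm_le (ζ : ℂ) z
  rwa [Circle.norm_coe, norm_sub_rev] at h

lemma poissonKernel_nonneg {z : ℂ} (hz : ‖z‖ < 1) (ζ : Circle) :
    0 ≤ (1 - ‖z‖ ^ 2) / ‖z - ζ‖ ^ 2 := by
  have : ‖z‖ ^ 2 ≤ 1 := pow_le_one₀ (norm_nonneg z) hz.le
  have := sub_nonneg.mpr this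
  positivity

lemma poissonIntegral_nonneg (μ : Measure Circle) {z : ℂ} (hz : ‖z‖ < 1) :
    0 ≤ poissonIntegral μ z :=
  integral_nonneg fun ζ => poissonKernel_nonneg hz ζ

lemma ofReal_poissonIntegral (μ : Measure Circle) [IsFiniteMeasure μ] {z : ℂ} (hz : ‖z‖ < 1) :
    ENNReal.ofReal (poissonIntegral μ z)
      = ∫⁻ ζ : Circle, ENNReal.ofReal ((1 - ‖z‖ ^ 2) / ‖z - ζ‖ ^ 2) ∂μ := by
  have hm : Measurable fun ζ : Circle => (1 - ‖z‖ ^ 2) / ‖z - ζ‖ ^ 2 := by fun_prop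
  refine ofReal_integral_eq_lintegral_ofReal ?_ (.of_forall fun ζ => poissonKernel_nonneg hz ζ)
  refine Integrable.of_bound hm.aestronglyMeasurable (1 / (1 - ‖z‖) ^ 2) (.of_forall fun ζ => ?_)
  rw [Real.norm_of_nonneg (poissonKernel_nonneg hz ζ)]
  have h1 := one_sub_norm_le_norm_sub_circle z ζ
  have h2 : 0 < 1 - ‖z‖ := by linarith
  gcongr
  have := sq_nonneg ‖z‖
  linarith

lemma measurable_poissonIntegral (μ : Measure Circle) [IsFiniteMeasure μ] :
    Measurable (poissonIntegral μ) := by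
  have : StronglyMeasurable fun p : ℂ × Circle => (1 - ‖p.1‖ ^ 2) / ‖p.1 - p.2‖ ^ 2 := by
    apply Measurable.stronglyMeasurable
    fun_prop
  exact this.integral_prod_right'.measurable

/-- The Poisson integral is integrable on the disc, as its kernel is at most `2 / |z - ζ|`. -/
lemma setLIntegral_poissonIntegral_lt_top (μ : Measure Circle) [IsFiniteMeasure μ] :
    ∫⁻ z in ball (0 : ℂ) 1, ENNReal.ofReal (poissonIntegral μ z) < ∞ := by
  have hm : Measurable fun p : ℂ × Circle => ENNReal.ofReal (2 * (1 / ‖p.1 - p.2‖)) := by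
    fun_prop
  calc ∫⁻ z in ball (0 : ℂ) 1, ENNReal.ofReal (poissonIntegral μ z)
      ≤ ∫⁻ z in ball (0 : ℂ) 1, ∫⁻ ζ : Circle, ENNReal.ofReal (2 * (1 / ‖z - ζ‖)) ∂μ := by
        apply setLIntegral_mono' measurableSet_ball
        intro z hz
        have hz1 : ‖z‖ < 1 := by simpa using hz
        rw [ofReal_poissonIntegral μ hz1]
        apply lintegral_mono
        intro ζ
        apply ENNReal.ofReal_le_ofReal
        have h1 := one_sub_norm_le_norm_sub_circle z ζ
        have h2 : 0 < 1 - ‖z‖ := by linarith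
        have h3 : 0 < ‖z - ζ‖ := h2.trans_le h1
        rw [div_le_iff₀ (by positivity)]
        have : 2 * (1 / ‖z - ζ‖) * ‖z - ζ‖ ^ 2 = 2 * ‖z - ζ‖ := by field_simp
        rw [this]
        nlinarith [norm_nonneg z]
    _ = ∫⁻ ζ : Circle, (∫⁻ z : ℂ in ball (0 : ℂ) 1, ENNReal.ofReal (2 * (1 / ‖z - ζ‖))) ∂μ :=
        lintegral_lintegral_swap hm.aemeasurable
    _ ≤ ∫⁻ _ : Circle, 2 * ENNReal.ofReal (4 * Real.pi) ∂μ := by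
        apply lintegral_mono
        intro ζ
        simp only
        simp_rw [ENNReal.ofReal_mul (zero_le_two (α := ℝ))]
        rw [lintegral_const_mul _ (by fun_prop)]
        gcongr
        · simp
        · exact setLIntegral_inv_norm_le (Circle.norm_coe ζ).le
    _ < ∞ := by
        rw [lintegral_const]
        exact ENNReal.mul_lt_top (ENNReal.mul_lt_top (by simp) ENNReal.ofReal_lt_top)
          (measure_lt_top μ _)

lemma poissonIntegral_le_of_dist {μ : Measure Circle} [IsFiniteMeasure μ] {z : ℂ} (hz : ‖z‖ < 1)
    {d : ℝ} (hd : 0 < d) (h : ∀ᵐ ζ : Circle ∂μ, d ≤ ‖z - ζ‖) :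
    poissonIntegral μ z ≤ (1 - ‖z‖ ^ 2) / d ^ 2 * μ.real univ := by
  have h0 : 0 ≤ 1 - ‖z‖ ^ 2 := sub_nonneg.mpr (pow_le_one₀ (norm_nonneg z) hz.le)
  have := norm_integral_le_of_norm_le_const (μ := μ)
    (f := fun ζ : Circle => (1 - ‖z‖ ^ 2) / ‖z - ζ‖ ^ 2) (C := (1 - ‖z‖ ^ 2) / d ^ 2) (by
      filter_upwards [h] with ζ hζ
      rw [Real.norm_of_nonneg (poissonKernel_nonneg hz ζ)]
      gcongr)
  exact (Real.le_norm_self _).trans this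

lemma dirichletIntegral_eq (μ : Measure Circle) (f : ℂ → ℂ) :
    dirichletIntegral μ f = ENNReal.ofReal (1 / Real.pi) *
      ∫⁻ z in ball (0 : ℂ) 1, ‖deriv f z‖ₑ ^ 2 * ENNReal.ofReal (poissonIntegral μ z) := by
  unfold dirichletIntegral
  congr 2
  funext z
  rw [ENNReal.ofReal_mul (by positivity), ENNReal.ofReal_pow (norm_nonneg _),
    ofReal_norm]

lemma hasDerivAt_szegoFun {w z : ℂ} (hw : ‖w‖ < 1) (hz : ‖z‖ ≤ 1) :
    HasDerivAt (szegoFun w) (conj w / (1 - conj w * z) ^ 2) z := by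
  have h := one_sub_conj_mul_ne hw hz
  have h1 : HasDerivAt (fun ζ : ℂ => 1 - conj w * ζ) (-(conj w * 1)) z :=
    ((hasDerivAt_id z).const_mul (conj w)).const_sub 1
  have h2 := h1.inv h
  have e : szegoFun w = (fun ζ : ℂ => 1 - conj w * ζ)⁻¹ := by
    funext ζ; simp [szegoFun]
  rw [e]
  exact h2.congr_deriv (by simp)

lemma norm_deriv_szegoFun {w z : ℂ} (hw : ‖w‖ < 1) (hz : ‖z‖ ≤ 1) :
    ‖deriv (szegoFun w) z‖ = ‖w‖ / ‖1 - conj w * z‖ ^ 2 := by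
  rw [(hasDerivAt_szegoFun hw hz).deriv]
  simp

lemma one_sub_norm_le_norm_one_sub {w z : ℂ} (hz : ‖z‖ ≤ 1) :
    1 - ‖w‖ ≤ ‖1 - conj w * z‖ := by
  have h := norm_sub_norm_le 1 (conj w * z)
  rw [norm_one, norm_mul, norm_conj] at h
  nlinarith [norm_nonneg w, norm_nonneg z]

lemma one_sub_norm_le_norm_one_sub' {w z : ℂ} (hw : ‖w‖ ≤ 1) :
    1 - ‖z‖ ≤ ‖1 - conj w * z‖ := by
  have h := norm_sub_norm_le 1 (conj w * z)
  rw [norm_one, norm_mul, norm_conj] at h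
  nlinarith [norm_nonneg w, norm_nonneg z]

/-- The quadratic potential `∫ |z - ζ|⁻² dμ(ζ)`, with values in `[0, ∞]`; at a point `z` of the
circle it is infinite as soon as `μ` charges `z`. -/
def quadraticPotential (μ : Measure Circle) (z : ℂ) : ℝ≥0∞ :=
  ∫⁻ ζ : Circle, (‖z - ζ‖ₑ ^ 2)⁻¹ ∂μ

lemma measurable_quadraticKernel (z : ℂ) : Measurable fun ζ : Circle => (‖z - ζ‖ₑ ^ 2)⁻¹ := by
  fun_prop

lemma inv_enorm_sq {x : ℂ} (hx : x ≠ 0) : (‖x‖ₑ ^ 2)⁻¹ = ENNReal.ofReal (1 / ‖x‖ ^ 2) := by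
  rw [one_div, ENNReal.ofReal_inv_of_pos (by positivity), ENNReal.ofReal_pow (norm_nonneg _),
    ofReal_norm]

/-- The Dirichlet integral of the Cauchy kernel at `w` is at least a constant times
`V(w) / (1 - |w|)`, where `V` is the quadratic potential. -/
lemma quadraticPotential_le_dirichletIntegral (μ : Measure Circle) [IsFiniteMeasure μ] {w : ℂ}
    (hw : ‖w‖ < 1) (hw2 : 1 / 2 ≤ ‖w‖) :
    quadraticPotential μ w ≤
      ENNReal.ofReal (3000 * (1 - ‖w‖)) * dirichletIntegral μ (szegoFun w) := by
  set δ := 1 - ‖w‖ with hδ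
  have hδ0 : 0 < δ := by linarith
  have hne : ∀ ζ : Circle, w - ζ ≠ 0 := fun ζ h => by
    have := one_sub_norm_le_norm_sub_circle w ζ
    rw [h, norm_zero] at this
    linarith
  -- On the disc of radius `δ / 2` about `w` the integrand is comparable to `δ⁻³ V`.
  have hsub : ball w (δ / 2) ⊆ ball (0 : ℂ) 1 := by
    intro z hz
    rw [mem_ball, dist_eq_norm] at hz
    have := norm_le_norm_add_norm_sub' z w
    rw [mem_ball_zero_iff]
    linarith
  have hpt : ∀ z ∈ ball w (δ / 2),
      ENNReal.ofReal (1 / (750 * δ ^ 3)) * quadraticPotential μ w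
        ≤ ENNReal.ofReal (‖deriv (szegoFun w) z‖ ^ 2 * poissonIntegral μ z) := by
    intro z hz
    have hz1 : ‖z‖ < 1 := by simpa using hsub hz
    rw [mem_ball, dist_eq_norm] at hz
    have hz2 : δ / 2 ≤ 1 - ‖z‖ := by
      have := norm_le_norm_add_norm_sub' z w
      linarith
    have hden : ‖1 - conj w * z‖ ≤ 5 / 2 * δ := by
      have e : 1 - conj w * z = ((1 - ‖w‖ ^ 2 : ℝ) : ℂ) + conj w * (w - z) := by
        rw [mul_sub, mul_comm (conj w) w, Complex.mul_conj, Complex.normSq_eq_norm_sq]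
        push_cast
        ring
      rw [e]
      refine (norm_add_le _ _).trans ?_
      rw [norm_mul, norm_conj, Complex.norm_real, norm_sub_rev w z,
        Real.norm_of_nonneg (by nlinarith [norm_nonneg w])]
      nlinarith [norm_nonneg w, norm_nonneg (z - w)]
    have hdpos : 0 < ‖1 - conj w * z‖ := hδ0.trans_le (one_sub_norm_le_norm_one_sub hz1.le)
    have hder : 1 / (160 * δ ^ 4) ≤ ‖deriv (szegoFun w) z‖ ^ 2 := by
      rw [norm_deriv_szegoFun hw hz1.le, div_pow, ← pow_mul]
      calc 1 / (160 * δ ^ 4) ≤ (1 / 2) ^ 2 / (5 / 2 * δ) ^ (2 * 2) := by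
            rw [div_le_div_iff₀ (by positivity) (by positivity)]
            have : 0 < δ ^ 4 := by positivity
            nlinarith
        _ ≤ _ := by gcongr
    have hker : ∀ ζ : Circle, 2 * δ / 9 * (1 / ‖w - ζ‖ ^ 2) ≤ (1 - ‖z‖ ^ 2) / ‖z - ζ‖ ^ 2 := by
      intro ζ
      have h1 := one_sub_norm_le_norm_sub_circle w ζ
      have h2 : ‖z - ζ‖ ≤ 3 / 2 * ‖w - ζ‖ := by
        have : z - ζ = (z - w) + (w - ζ) := by ring
        rw [this]
        refine (norm_add_le _ _).trans ?_
        linarith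
      have h3 : 0 < ‖z - ζ‖ := by
        have := one_sub_norm_le_norm_sub_circle z ζ
        linarith
      have h4 : 0 < ‖w - ζ‖ := norm_pos_iff.mpr (hne ζ)
      calc 2 * δ / 9 * (1 / ‖w - ζ‖ ^ 2) = (δ / 2) / (3 / 2 * ‖w - ζ‖) ^ 2 := by
            field_simp; norm_num
        _ ≤ _ := by
            have h5 : δ / 2 ≤ 1 - ‖z‖ ^ 2 := by nlinarith [norm_nonneg z]
            have h6 : 0 ≤ 1 - ‖z‖ ^ 2 := by linarith
            gcongr
    rw [ENNReal.ofReal_mul (by positivity), ofReal_poissonIntegral μ hz1]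
    calc ENNReal.ofReal (1 / (750 * δ ^ 3)) * quadraticPotential μ w
        ≤ ENNReal.ofReal (1 / (160 * δ ^ 4)) * (ENNReal.ofReal (2 * δ / 9) *
            quadraticPotential μ w) := by
          rw [← mul_assoc, ← ENNReal.ofReal_mul (by positivity)]
          gcongr
          rw [div_mul_div_comm, div_le_div_iff₀ (by positivity) (by positivity)]
          have : 0 < δ ^ 4 := by positivity
          nlinarith
      _ ≤ _ := by
          gcongr
          unfold quadraticPotential
          rw [← lintegral_const_mul _ (measurable_quadraticKernel w)]
          apply lintegral_mono
          intro ζ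
          simp only
          rw [inv_enorm_sq (hne ζ), ← ENNReal.ofReal_mul (by positivity)]
          exact ENNReal.ofReal_le_ofReal (hker ζ)
  have hint : ENNReal.ofReal (1 / (750 * δ ^ 3)) * quadraticPotential μ w *
      volume (ball w (δ / 2)) ≤
      ∫⁻ z in ball (0 : ℂ) 1, ENNReal.ofReal (‖deriv (szegoFun w) z‖ ^ 2 * poissonIntegral μ z) := by
    rw [← setLIntegral_const]
    exact (setLIntegral_mono' measurableSet_ball hpt).trans (lintegral_mono_set hsub)
  have hπ := Real.pi_pos
  calc quadraticPotential μ w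
      = ENNReal.ofReal (3000 * δ) * (ENNReal.ofReal (1 / Real.pi) *
        (ENNReal.ofReal (1 / (750 * δ ^ 3)) * quadraticPotential μ w *
          volume (ball w (δ / 2)))) := by
        have hv : volume (ball w (δ / 2)) = ENNReal.ofReal ((δ / 2) ^ 2 * Real.pi) := by
          rw [Complex.volume_ball, ENNReal.ofReal_mul (by positivity),
            ENNReal.ofReal_pow (by positivity), ← NNReal.coe_real_pi, ENNReal.ofReal_coe_nnreal]
        rw [hv]
        rw [show ∀ x y z v u : ℝ≥0∞, x * (y * (z * v * u)) = (x * y * z * u) * v by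
          intros; ring, ← ENNReal.ofReal_mul (by positivity), ← ENNReal.ofReal_mul (by positivity),
          ← ENNReal.ofReal_mul (by positivity)]
        rw [show 3000 * δ * (1 / Real.pi) * (1 / (750 * δ ^ 3)) * ((δ / 2) ^ 2 * Real.pi) = 1 by
          field_simp; norm_num]
        simp
    _ ≤ _ := by
        unfold dirichletIntegral
        gcongr

lemma dirichletIntegral_szegoFun_lt_top (μ : Measure Circle) [IsFiniteMeasure μ] {w : ℂ}
    (hw : ‖w‖ < 1) : dirichletIntegral μ (szegoFun w) < ∞ := by
  have h0 : 0 < 1 - ‖w‖ := by linarith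
  rw [dirichletIntegral_eq]
  refine ENNReal.mul_lt_top ENNReal.ofReal_lt_top ?_
  calc _ ≤ ∫⁻ z in ball (0 : ℂ) 1, ENNReal.ofReal ((1 / (1 - ‖w‖) ^ 2) ^ 2) *
          ENNReal.ofReal (poissonIntegral μ z) := by
        apply setLIntegral_mono' measurableSet_ball
        intro z hz
        have hz1 : ‖z‖ < 1 := by simpa using hz
        gcongr
        rw [← ofReal_norm, ← ENNReal.ofReal_pow (norm_nonneg _),
          norm_deriv_szegoFun hw hz1.le]
        apply ENNReal.ofReal_le_ofReal
        have := one_sub_norm_le_norm_one_sub (w := w) hz1.le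
        gcongr
    _ < ∞ := by
        rw [lintegral_const_mul _ (measurable_poissonIntegral μ).ennreal_ofReal]
        exact ENNReal.mul_lt_top ENNReal.ofReal_lt_top (setLIntegral_poissonIntegral_lt_top μ)

/-- Away from the support of `μ` the Dirichlet integral of the Cauchy kernel at `w` grows no faster
than its squared `H²` norm. -/
lemma exists_dirichletIntegral_szegoFun_le {μ : Measure Circle} [IsFiniteMeasure μ] {ξ : Circle}
    (hξ : ξ ∉ μ.support) :
    ∃ ε > 0, ∃ K : ℝ, ∀ w : ℂ, ‖w‖ < 1 → ‖w - ξ‖ < ε →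
      ENNReal.ofReal (1 - ‖w‖) * dirichletIntegral μ (szegoFun w) ≤ ENNReal.ofReal K := by
  obtain ⟨U, hU, hμU⟩ := Measure.notMem_support_iff_exists.mp hξ
  obtain ⟨d', hd', hdU⟩ := Metric.mem_nhds_iff.mp hU
  set d := min d' 1 with hd
  have hd0 : 0 < d := by positivity
  have hd1 : d ≤ 1 := min_le_right _ _
  have hae : ∀ᵐ ζ : Circle ∂μ, d ≤ ‖(ξ : ℂ) - ζ‖ := by
    filter_upwards [measure_eq_zero_iff_ae_notMem.mp hμU] with ζ hζ
    by_contra! hlt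
    apply hζ
    apply hdU
    change dist (ζ : ℂ) ξ < d'
    rw [dist_eq_norm, norm_sub_rev]
    exact hlt.trans_le (min_le_left _ _)
  set m := μ.real univ with hm
  have hm0 : 0 ≤ m := measureReal_nonneg
  set A := 64 * m / d ^ 2 with hA
  set B := (4 / d) ^ 4 with hB
  set I := ∫⁻ z in ball (0 : ℂ) 1, ENNReal.ofReal (poissonIntegral μ z) with hI
  have hIt : I < ∞ := setLIntegral_poissonIntegral_lt_top μ
  refine ⟨d / 4, by positivity, 1 / Real.pi * (A * (2 * Real.pi) + B * I.toReal), ?_⟩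
  intro w hw hwξ
  have hw2 : 1 / 2 ≤ ‖w‖ := by
    have := norm_sub_norm_le (ξ : ℂ) w
    rw [Circle.norm_coe, norm_sub_rev] at this
    linarith
  have hw0 : 0 < ‖w‖ := by linarith
  have hwne : conj w ≠ 0 := by simpa using hw0.ne'
  set δ := 1 - ‖w‖ with hδ
  have hδ0 : 0 < δ := by linarith
  -- The Cauchy kernel at `w` has its pole at `v`, at distance at least `δ` from the disc.
  set v := (conj w)⁻¹ with hv
  have hden : ∀ z : ℂ, ‖1 - conj w * z‖ = ‖w‖ * ‖z - v‖ := by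
    intro z
    have : 1 - conj w * z = - (conj w * (z - v)) := by
      rw [hv]; field_simp; ring
    rw [this, norm_neg, norm_mul, norm_conj]
  -- Near `ξ` the Poisson integral is `O(1 - |z|)`, which cancels one power of the singularity;
  -- far from `ξ` the Cauchy kernel at `w` is bounded.
  have hpt : ∀ z ∈ ball (0 : ℂ) 1,
      ENNReal.ofReal (‖deriv (szegoFun w) z‖ ^ 2 * poissonIntegral μ z) ≤
        {z : ℂ | δ ≤ ‖z - v‖}.indicator
          (fun z => ENNReal.ofReal A * ENNReal.ofReal (1 / ‖z - v‖ ^ 3)) z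
          + ENNReal.ofReal B * ENNReal.ofReal (poissonIntegral μ z) := by
    intro z hz
    have hz1 : ‖z‖ < 1 := by simpa using hz
    have hP := poissonIntegral_nonneg μ hz1
    have hn1 := one_sub_norm_le_norm_one_sub (w := w) hz1.le
    have hn2 := one_sub_norm_le_norm_one_sub' (z := z) hw.le
    have hn0 : 0 < ‖1 - conj w * z‖ := hδ0.trans_le hn1
    have hzv : δ ≤ ‖z - v‖ := by
      rw [hden] at hn1
      nlinarith [norm_nonneg (z - v)]
    have hzv0 : 0 < ‖z - v‖ := hδ0.trans_le hzv
    rw [indicator_of_mem (show z ∈ {z : ℂ | δ ≤ ‖z - v‖} from hzv),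
      ← ENNReal.ofReal_mul (by positivity), ← ENNReal.ofReal_mul (by positivity),
      ← ENNReal.ofReal_add (by positivity) (by positivity)]
    apply ENNReal.ofReal_le_ofReal
    rw [norm_deriv_szegoFun hw hz1.le]
    by_cases hcase : ‖z - ξ‖ < d / 2
    · have hae' : ∀ᵐ ζ : Circle ∂μ, d / 2 ≤ ‖z - ζ‖ := by
        filter_upwards [hae] with ζ hζ
        have : (ξ : ℂ) - ζ = (z - ζ) - (z - ξ) := by ring
        rw [this] at hζ
        have := norm_sub_le (z - (ζ : ℂ)) (z - ξ)
        linarith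
      have hPz := poissonIntegral_le_of_dist hz1 (by positivity : 0 < d / 2) hae'
      have hPz' : poissonIntegral μ z ≤ 8 * m / d ^ 2 * ‖1 - conj w * z‖ := by
        refine hPz.trans ?_
        have : (1 - ‖z‖ ^ 2) / (d / 2) ^ 2 * m = 4 * m / d ^ 2 * (1 - ‖z‖ ^ 2) := by
          field_simp; ring
        rw [← hm, this]
        have h2 : 1 - ‖z‖ ^ 2 ≤ 2 * ‖1 - conj w * z‖ := by nlinarith [norm_nonneg z]
        calc _ ≤ 4 * m / d ^ 2 * (2 * ‖1 - conj w * z‖) := by gcongr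
          _ = _ := by ring
      have : (‖w‖ / ‖1 - conj w * z‖ ^ 2) ^ 2 * poissonIntegral μ z ≤ A * (1 / ‖z - v‖ ^ 3) := by
        calc (‖w‖ / ‖1 - conj w * z‖ ^ 2) ^ 2 * poissonIntegral μ z
            ≤ (1 / ‖1 - conj w * z‖ ^ 2) ^ 2 * (8 * m / d ^ 2 * ‖1 - conj w * z‖) := by
              gcongr
          _ = 8 * m / d ^ 2 * (1 / ‖1 - conj w * z‖ ^ 3) := by field_simp
          _ ≤ 8 * m / d ^ 2 * (1 / (1 / 2 * ‖z - v‖) ^ 3) := by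
              rw [hden]
              gcongr
          _ = A * (1 / ‖z - v‖ ^ 3) := by rw [hA]; field_simp; ring
      have h3 : 0 ≤ B * poissonIntegral μ z := by positivity
      linarith
    · push Not at hcase
      have hn3 : d / 4 ≤ ‖1 - conj w * z‖ := by
        have e : 1 - conj w * z = conj (ξ : ℂ) * (ξ - z) - conj (w - ξ) * z := by
          have : conj (ξ : ℂ) * ξ = 1 := by
            rw [mul_comm, Complex.mul_conj, Complex.normSq_eq_norm_sq, Circle.norm_coe]
            simp
          rw [map_sub, mul_sub, this]
          ring
        rw [e]
        have h5 := norm_sub_norm_le (conj (ξ : ℂ) * (ξ - z)) (conj (w - ξ) * z)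
        rw [norm_mul, norm_mul, norm_conj, norm_conj, Circle.norm_coe, one_mul,
          norm_sub_rev (ξ : ℂ) z] at h5
        nlinarith [norm_nonneg z, norm_nonneg (w - (ξ : ℂ))]
      have : (‖w‖ / ‖1 - conj w * z‖ ^ 2) ^ 2 * poissonIntegral μ z ≤ B * poissonIntegral μ z := by
        gcongr
        calc (‖w‖ / ‖1 - conj w * z‖ ^ 2) ^ 2 ≤ (1 / (d / 4) ^ 2) ^ 2 := by gcongr
          _ = B := by rw [hB]; field_simp
      have h3 : 0 ≤ A * (1 / ‖z - v‖ ^ 3) := by positivity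
      linarith
  have hms : MeasurableSet {z : ℂ | δ ≤ ‖z - v‖} := measurableSet_le (by fun_prop) (by fun_prop)
  have hPm := (measurable_poissonIntegral μ).ennreal_ofReal
  have hint : ∫⁻ z in ball (0 : ℂ) 1,
      ENNReal.ofReal (‖deriv (szegoFun w) z‖ ^ 2 * poissonIntegral μ z) ≤
      ENNReal.ofReal A * ENNReal.ofReal (2 * Real.pi / δ) + ENNReal.ofReal B * I := by
    refine (setLIntegral_mono' measurableSet_ball hpt).trans ?_
    rw [lintegral_add_right _ (hPm.const_mul _), lintegral_const_mul _ hPm]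
    gcongr
    refine (setLIntegral_le_lintegral _ _).trans ?_
    rw [lintegral_indicator hms, lintegral_const_mul _ (by fun_prop)]
    gcongr
    exact setLIntegral_inv_norm_pow_three_le v hδ0
  have hA0 : 0 ≤ A := by positivity
  have hB0 : 0 ≤ B := by positivity
  have hπ := Real.pi_pos
  calc ENNReal.ofReal δ * dirichletIntegral μ (szegoFun w)
      ≤ ENNReal.ofReal δ * (ENNReal.ofReal (1 / Real.pi) *
        (ENNReal.ofReal A * ENNReal.ofReal (2 * Real.pi / δ) + ENNReal.ofReal B * I)) := by
        unfold dirichletIntegral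
        gcongr
    _ = ENNReal.ofReal (δ * (1 / Real.pi * (A * (2 * Real.pi / δ) + B * I.toReal))) := by
        rw [← ENNReal.ofReal_toReal hIt.ne]
        rw [ENNReal.ofReal_mul hδ0.le, ENNReal.ofReal_mul (by positivity),
          ENNReal.ofReal_add (by positivity) (by positivity), ENNReal.ofReal_mul hA0,
          ENNReal.ofReal_mul hB0, ENNReal.toReal_ofReal ENNReal.toReal_nonneg]
    _ ≤ _ := by
        apply ENNReal.ofReal_le_ofReal
        have e1 : δ * (1 / Real.pi * (A * (2 * Real.pi / δ) + B * I.toReal)) =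
          1 / Real.pi * (A * (2 * Real.pi) + δ * (B * I.toReal)) := by field_simp
        rw [e1]
        have : 0 ≤ B * I.toReal := by positivity
        have h6 : δ * (B * I.toReal) ≤ B * I.toReal := by nlinarith
        gcongr

/-! ### Boundary behaviour of Pythagorean pairs -/

lemma one_sub_norm_sq_pos {z : ℂ} (hz : ‖z‖ < 1) : 0 < 1 - ‖z‖ ^ 2 := by
  nlinarith [norm_nonneg z]

/-- The real part of the Herglotz kernel is the Poisson kernel. -/
lemma re_herglotz_kernel {ζ z : ℂ} (hζ : ‖ζ‖ = 1) :
    ((ζ + z) / (ζ - z)).re = (1 - ‖z‖ ^ 2) / ‖ζ - z‖ ^ 2 := by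
  rw [Complex.div_re, ← Complex.normSq_eq_norm_sq, ← Complex.normSq_eq_norm_sq, ← add_div]
  congr 1
  have h1 : normSq ζ = 1 := by rw [Complex.normSq_eq_norm_sq, hζ]; norm_num
  rw [normSq_apply] at h1
  simp only [normSq_apply, add_re, sub_re, add_im, sub_im]
  linarith

lemma circleMap_zero_one_eq (t : ℝ) : circleMap 0 1 t = (Circle.exp t : ℂ) := by
  simp [circleMap]

lemma sub_ne_zero_of_norm_lt {ζ z : ℂ} (hζ : ‖ζ‖ = 1) (hz : ‖z‖ < 1) : ζ - z ≠ 0 := by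
  intro h
  rw [sub_eq_zero] at h
  rw [h] at hζ
  linarith

lemma circleIntegrable_mul_of_continuousOn {g f : ℂ → ℂ} (hg : ContinuousOn g (sphere 0 1))
    (hf : CircleIntegrable f 0 1) : CircleIntegrable (fun ζ => g ζ * f ζ) 0 1 := by
  refine IntervalIntegrable.continuousOn_mul hf ?_
  refine hg.comp (continuous_circleMap 0 1).continuousOn fun θ _ => ?_
  simp

lemma circleIntegrable_herglotz {k : ℂ → ℝ} (hk : CircleIntegrable k 0 1) {z : ℂ} (hz : ‖z‖ < 1) :
    CircleIntegrable (fun ζ => (ζ + z) / (ζ - z) * (k ζ : ℂ)) 0 1 := by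
  refine circleIntegrable_mul_of_continuousOn ?_ ⟨hk.1.ofReal, hk.2.ofReal⟩
  refine ContinuousOn.div (by fun_prop) (by fun_prop) fun ζ hζ => ?_
  exact sub_ne_zero_of_norm_lt (by simpa using hζ) hz

lemma circleIntegrable_poisson_mul {k : ℂ → ℝ} (hk : CircleIntegrable k 0 1) {z : ℂ}
    (hz : ‖z‖ < 1) :
    CircleIntegrable (fun ζ => (1 - ‖z‖ ^ 2) / ‖ζ - z‖ ^ 2 * k ζ) 0 1 := by
  refine IntervalIntegrable.continuousOn_mul hk ?_
  refine Continuous.continuousOn ?_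
  refine Continuous.div (by fun_prop) (by fun_prop) fun θ => ?_
  have := sub_ne_zero_of_norm_lt (ζ := circleMap 0 1 θ) (by simp) hz
  positivity

/-- The data of a Pythagorean pair at the boundary: `k = log |a|` there, and radial limits of `a`
and `b` exist almost everywhere. The last clause is the modulus of the outer representation of
`a`, as the exponential of a Poisson integral. -/
structure BoundaryData (b a : ℂ → ℂ) (k : ℂ → ℝ) : Prop where
  integrable : CircleIntegrable k 0 1
  diff : DifferentiableOn ℂ a (ball 0 1)
  limits : ∀ᵐ t : ℝ, ∃ α β : ℂ, HasRadialLimit a (Circle.exp t) α ∧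
    HasRadialLimit b (Circle.exp t) β ∧ ‖α‖ ^ 2 + ‖β‖ ^ 2 = 1 ∧
    ‖α‖ = Real.exp (k (circleMap 0 1 t))
  norm_eq : ∀ z : ℂ, ‖z‖ < 1 → ‖a z‖ =
    Real.exp (Real.circleAverage (fun ζ => (1 - ‖z‖ ^ 2) / ‖ζ - z‖ ^ 2 * k ζ) 0 1)

/-- The Herglotz kernel is `2 ζ / (ζ - z) - 1`, so its transform of `k` is a Cauchy integral up to a
constant. -/
lemma differentiableOn_herglotz_transform {k : ℂ → ℝ} (hk : CircleIntegrable k 0 1) :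
    DifferentiableOn ℂ
      (fun z => Real.circleAverage (fun ζ => (ζ + z) / (ζ - z) * (k ζ : ℂ)) 0 1) (ball 0 1) := by
  have hkc : CircleIntegrable (fun ζ => (k ζ : ℂ)) 0 1 := ⟨hk.1.ofReal, hk.2.ofReal⟩
  have h1 := hasFPowerSeriesOn_cauchy_integral (R := 1) hkc one_pos
  have h2 : DifferentiableOn ℂ (fun w => (2 * Real.pi * I : ℂ)⁻¹ •
      ∮ z in C(0, 1), (z - w)⁻¹ • (k z : ℂ)) (ball 0 1) := by
    have := h1.differentiableOn
    rwa [eball_coe] at this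
  have h3 : DifferentiableOn ℂ (fun w => 2 * ((2 * Real.pi * I : ℂ)⁻¹ •
      ∮ z in C(0, 1), (z - w)⁻¹ • (k z : ℂ)) - Real.circleAverage (fun ζ => (k ζ : ℂ)) 0 1)
      (ball 0 1) := (h2.const_mul 2).sub_const _
  refine h3.congr fun z hz => ?_
  have hz1 : ‖z‖ < 1 := by simpa using hz
  have hc : Real.circleAverage (fun ζ => ζ / (ζ - z) * (k ζ : ℂ)) 0 1
      = (2 * Real.pi * I : ℂ)⁻¹ • ∮ ζ in C(0, 1), (ζ - z)⁻¹ • (k ζ : ℂ) := by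
    rw [Real.circleAverage_eq_circleIntegral one_ne_zero]
    congr 1
    refine circleIntegral.integral_congr zero_le_one fun ζ hζ => ?_
    have h0 : ζ ≠ 0 := by
      rintro rfl
      simp at hζ
    have := sub_ne_zero_of_norm_lt (ζ := ζ) (by simpa using hζ) hz1
    simp only [smul_eq_mul, sub_zero]
    field_simp
  have hi : CircleIntegrable (fun ζ => ζ / (ζ - z) * (k ζ : ℂ)) 0 1 := by
    refine circleIntegrable_mul_of_continuousOn ?_ hkc
    refine ContinuousOn.div (by fun_prop) (by fun_prop) fun ζ hζ => ?_
    exact sub_ne_zero_of_norm_lt (by simpa using hζ) hz1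
  have hi2 : CircleIntegrable (fun ζ => (2 : ℂ) • (ζ / (ζ - z) * (k ζ : ℂ))) 0 1 := hi.const_smul
  rw [← hc, ← smul_eq_mul, ← Real.circleAverage_fun_smul (a := (2 : ℂ)),
    ← Real.circleAverage_fun_sub hi2 hkc]
  refine Real.circleAverage_congr_sphere fun ζ hζ => ?_
  have := sub_ne_zero_of_norm_lt (ζ := ζ) (by simpa using hζ) hz1
  simp only [smul_eq_mul]
  field_simp
  ring

lemma IsPythagoreanPair.exists_boundaryData {b a : ℂ → ℂ} (h : IsPythagoreanPair b a) :
    ∃ k, BoundaryData b a k := by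
  obtain ⟨c, k, hc, hk, hlim, hform⟩ := h.outer
  refine ⟨k, hk, ?_, ?_, ?_⟩
  · refine DifferentiableOn.congr (f := fun z => c * exp
      (Real.circleAverage (fun ζ => (ζ + z) / (ζ - z) * (k ζ : ℂ)) 0 1)) ?_ hform
    exact (differentiableOn_herglotz_transform hk).cexp.const_mul c
  · filter_upwards [hlim, h.sq_add_sq] with t ⟨v, hv, hvk⟩ ⟨α, β, hα, hβ, hαβ⟩
    refine ⟨α, β, hα, hβ, hαβ, ?_⟩
    rw [tendsto_nhds_unique hα hv, hvk, circleMap_zero_one_eq]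
  · intro z hz
    rw [hform z (by simpa using hz), norm_mul, hc, one_mul, Complex.norm_exp]
    congr 1
    have := Complex.reCLM.circleAverage_comp_comm (circleIntegrable_herglotz hk hz)
    change _ = Complex.re _ at this
    rw [← this]
    refine Real.circleAverage_congr_sphere fun ζ hζ => ?_
    have hζ1 : ‖ζ‖ = 1 := by simpa using hζ
    change Complex.re _ = _
    rw [Complex.re_mul_ofReal, re_herglotz_kernel hζ1]

lemma BoundaryData.log_nonpos {b a : ℂ → ℂ} {k : ℂ → ℝ} (h : BoundaryData b a k) :
    ∀ᵐ t : ℝ, k (circleMap 0 1 t) ≤ 0 := by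
  filter_upwards [h.limits] with t ⟨α, β, _, _, h1, h2⟩
  have h3 : ‖α‖ ≤ 1 := by nlinarith [norm_nonneg α, norm_nonneg β]
  rw [h2] at h3
  exact Real.exp_le_one_iff.mp h3

lemma circleAverage_mono_ae {f g : ℂ → ℝ} (hf : CircleIntegrable f 0 1)
    (hg : CircleIntegrable g 0 1)
    (h : ∀ᵐ t : ℝ, f (circleMap 0 1 t) ≤ g (circleMap 0 1 t)) :
    Real.circleAverage f 0 1 ≤ Real.circleAverage g 0 1 := by
  have := Real.pi_pos
  rw [Real.circleAverage_def, Real.circleAverage_def, smul_eq_mul, smul_eq_mul]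
  gcongr
  exact intervalIntegral.integral_mono_ae (by positivity) hf hg h

lemma BoundaryData.norm_le_one {b a : ℂ → ℂ} {k : ℂ → ℝ} (h : BoundaryData b a k) {z : ℂ}
    (hz : ‖z‖ < 1) : ‖a z‖ ≤ 1 := by
  rw [h.norm_eq z hz, Real.exp_le_one_iff]
  have h0 := circleAverage_mono_ae (circleIntegrable_poisson_mul h.integrable hz)
    (circleIntegrable_const (0 : ℝ) 0 1) (by
      filter_upwards [h.log_nonpos] with t ht
      have := one_sub_norm_sq_pos hz
      exact mul_nonpos_of_nonneg_of_nonpos (by positivity) ht)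
  rwa [Real.circleAverage_const] at h0

lemma BoundaryData.ne_zero {b a : ℂ → ℂ} {k : ℂ → ℝ} (h : BoundaryData b a k) {z : ℂ}
    (hz : ‖z‖ < 1) : a z ≠ 0 := by
  rw [← norm_pos_iff, h.norm_eq z hz]
  exact Real.exp_pos _

/-! ### The row Toeplitz contraction -/

lemma mul_mem_ball_of_mem_closedBall {r : ℝ} (hr : r ∈ Ioo (0 : ℝ) 1) {z : ℂ}
    (hz : z ∈ closedBall (0 : ℂ) 1) : (r : ℂ) * z ∈ ball (0 : ℂ) 1 := by
  rw [mem_closedBall_zero_iff] at hz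
  rw [mem_ball_zero_iff, norm_mul, Complex.norm_real, Real.norm_of_nonneg hr.1.le]
  nlinarith [hr.1, hr.2, norm_nonneg z]

lemma diffContOnCl_dilate {f : ℂ → ℂ} (hf : DifferentiableOn ℂ f (ball 0 1)) {r : ℝ}
    (hr : r ∈ Ioo (0 : ℝ) 1) : DiffContOnCl ℂ (fun ζ => f (r * ζ)) (ball 0 1) := by
  apply DifferentiableOn.diffContOnCl
  rw [closure_ball (0 : ℂ) one_ne_zero]
  exact hf.comp (by fun_prop) fun z hz => mul_mem_ball_of_mem_closedBall hr hz

lemma tendsto_dilate {f : ℂ → ℂ} (hf : DifferentiableOn ℂ f (ball 0 1)) {z : ℂ} (hz : ‖z‖ < 1) :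
    Tendsto (fun r : ℝ => f (r * z)) (𝓝[<] 1) (𝓝 (f z)) := by
  have hc : ContinuousAt f z :=
    (hf.differentiableAt (isOpen_ball.mem_nhds (by simpa using hz))).continuousAt
  have h2 : Tendsto (fun r : ℝ => (r : ℂ) * z) (𝓝[<] 1) (𝓝 z) := by
    have : Continuous fun r : ℝ => (r : ℂ) * z := by fun_prop
    have := this.tendsto 1
    simp only [ofReal_one, one_mul] at this
    exact this.mono_left nhdsWithin_le_nhds
  exact hc.tendsto.comp h2

lemma re_mul_conj_self (z : ℂ) : (z * conj z).re = ‖z‖ ^ 2 := by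
  rw [Complex.mul_conj, Complex.normSq_eq_norm_sq, Complex.ofReal_re]

lemma circleIntegrable_norm_sq {G : ℂ → ℂ} (hG : DiffContOnCl ℂ G (ball 0 1)) :
    CircleIntegrable (fun ζ => ‖G ζ‖ ^ 2) 0 1 := by
  have h := circleIntegrable_mul_conj hG hG
  have h2 : CircleIntegrable (fun ζ => (G ζ * conj (G ζ)).re) 0 1 :=
    ⟨Integrable.re h.1, Integrable.re h.2⟩
  simpa only [re_mul_conj_self] using h2

/-- Since `|a|² + |b|² = 1` on the circle, dilating `a` and `b` loses no mass in the limit. -/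
lemma BoundaryData.tendsto_circleAverage {b a : ℂ → ℂ} {k : ℂ → ℝ} (h : BoundaryData b a k)
    (hb : IsSchur b) {G : ℂ → ℂ} (hG : DiffContOnCl ℂ G (ball 0 1)) :
    Tendsto (fun r : ℝ => Real.circleAverage
        (fun ζ => (‖b (r * ζ)‖ ^ 2 + ‖a (r * ζ)‖ ^ 2) * ‖G ζ‖ ^ 2) 0 1) (𝓝[<] 1)
      (𝓝 (Real.circleAverage (fun ζ => ‖G ζ‖ ^ 2) 0 1)) := by
  simp only [Real.circleAverage_def]
  refine Tendsto.const_smul ?_ _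
  refine intervalIntegral.tendsto_integral_filter_of_dominated_convergence
    (fun θ => 2 * ‖G (circleMap 0 1 θ)‖ ^ 2) ?_ ?_ ((circleIntegrable_norm_sq hG).const_mul 2) ?_
  · filter_upwards [Ioo_mem_nhdsLT (zero_lt_one (α := ℝ))] with r hr
    have h1 := circleIntegrable_norm_sq ((diffContOnCl_dilate hb.diff hr).smul hG)
    have h2 := circleIntegrable_norm_sq ((diffContOnCl_dilate h.diff hr).smul hG)
    have h3 := (h1.add h2).aestronglyMeasurable
    rw [uIoc_of_le (by positivity)]
    refine h3.congr (.of_forall fun θ => ?_)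
    simp only [Pi.add_apply, smul_eq_mul, norm_mul]
    ring
  · filter_upwards [Ioo_mem_nhdsLT (zero_lt_one (α := ℝ))] with r hr
    refine .of_forall fun θ _ => ?_
    have hm := mul_mem_ball_of_mem_closedBall hr (z := circleMap 0 1 θ) (by simp)
    have h1 := hb.bound _ hm
    have h2 := h.norm_le_one (mem_ball_zero_iff.mp hm)
    rw [Real.norm_of_nonneg (by positivity)]
    have h3 := pow_le_one₀ (n := 2) (norm_nonneg _) h1
    have h4 := pow_le_one₀ (n := 2) (norm_nonneg _) h2
    gcongr
    linarith
  · filter_upwards [h.limits] with θ ⟨α, β, hα, hβ, hs, _⟩ _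
    have h1 := ((hβ.norm.pow 2).add (hα.norm.pow 2)).mul_const (‖G (circleMap 0 1 θ)‖ ^ 2)
    rw [add_comm (‖β‖ ^ 2), hs, one_mul] at h1
    simpa only [circleMap_zero_one_eq] using h1

/-- The limit form, as `r → 1`, of the nonnegativity of the average over the circle of
`|h - b_r G|² + |g - a_r G|²`, where `f_r(ζ) = f(r ζ)`. -/
lemma BoundaryData.two_re_le {b a : ℂ → ℂ} {k : ℂ → ℝ} (hd : BoundaryData b a k)
    (hb : IsSchur b) {h g G : ℂ → ℂ} (hh : DiffContOnCl ℂ h (ball 0 1))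
    (hg : DiffContOnCl ℂ g (ball 0 1)) (hG : DiffContOnCl ℂ G (ball 0 1)) {L : ℂ}
    (hL : Tendsto (fun r : ℝ =>
      Real.circleAverage (fun ζ => b (r * ζ) * G ζ * conj (h ζ)) 0 1 +
      Real.circleAverage (fun ζ => a (r * ζ) * G ζ * conj (g ζ)) 0 1) (𝓝[<] 1) (𝓝 L)) :
    2 * L.re ≤ Real.circleAverage (fun ζ => ‖h ζ‖ ^ 2) 0 1 +
      Real.circleAverage (fun ζ => ‖g ζ‖ ^ 2) 0 1 +
      Real.circleAverage (fun ζ => ‖G ζ‖ ^ 2) 0 1 := by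
  have hlim := ((hd.tendsto_circleAverage hb hG).const_add
    (Real.circleAverage (fun ζ => ‖h ζ‖ ^ 2) 0 1 + Real.circleAverage (fun ζ => ‖g ζ‖ ^ 2) 0 1)).sub
    (((Complex.continuous_re.tendsto _).comp hL).const_mul 2)
  refine sub_nonneg.mp (ge_of_tendsto hlim ?_)
  filter_upwards [Ioo_mem_nhdsLT (zero_lt_one (α := ℝ))] with r hr
  have db := (diffContOnCl_dilate hb.diff hr).smul hG
  have da := (diffContOnCl_dilate hd.diff hr).smul hG
  have ib := circleIntegrable_norm_sq db
  have ia := circleIntegrable_norm_sq da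
  have jb := circleIntegrable_mul_conj db hh
  have ja := circleIntegrable_mul_conj da hg
  have jb' : CircleIntegrable (fun ζ => (b (r * ζ) * G ζ * conj (h ζ)).re) 0 1 :=
    ⟨Integrable.re jb.1, Integrable.re jb.2⟩
  have ja' : CircleIntegrable (fun ζ => (a (r * ζ) * G ζ * conj (g ζ)).re) 0 1 :=
    ⟨Integrable.re ja.1, Integrable.re ja.2⟩
  have eb := Complex.reCLM.circleAverage_comp_comm jb
  have ea := Complex.reCLM.circleAverage_comp_comm ja
  change Real.circleAverage (fun ζ => (b (r * ζ) * G ζ * conj (h ζ)).re) 0 1 = Complex.re _ at eb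
  change Real.circleAverage (fun ζ => (a (r * ζ) * G ζ * conj (g ζ)).re) 0 1 = Complex.re _ at ea
  have i1 := circleIntegrable_norm_sq hh
  have i2 := circleIntegrable_norm_sq hg
  have i3 : CircleIntegrable
      (fun ζ => (‖b (r * ζ)‖ ^ 2 + ‖a (r * ζ)‖ ^ 2) * ‖G ζ‖ ^ 2) 0 1 := by
    refine (ib.add ia).congr fun ζ _ => ?_
    simp only [Pi.add_apply, smul_eq_mul, norm_mul]
    ring
  have hpos : 0 ≤ Real.circleAverage (fun ζ => (‖h ζ‖ ^ 2 + ‖g ζ‖ ^ 2 +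
      (‖b (r * ζ)‖ ^ 2 + ‖a (r * ζ)‖ ^ 2) * ‖G ζ‖ ^ 2) -
      (2 : ℝ) • ((b (r * ζ) * G ζ * conj (h ζ)).re + (a (r * ζ) * G ζ * conj (g ζ)).re)) 0 1 := by
    refine Real.circleAverage_nonneg_of_nonneg fun ζ _ => ?_
    have : (‖h ζ‖ ^ 2 + ‖g ζ‖ ^ 2 + (‖b (r * ζ)‖ ^ 2 + ‖a (r * ζ)‖ ^ 2) * ‖G ζ‖ ^ 2) -
      (2 : ℝ) • ((b (r * ζ) * G ζ * conj (h ζ)).re + (a (r * ζ) * G ζ * conj (g ζ)).re) =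
      ‖h ζ - b (r * ζ) * G ζ‖ ^ 2 + ‖g ζ - a (r * ζ) * G ζ‖ ^ 2 := by
      simp only [← Complex.normSq_eq_norm_sq, normSq_apply, sub_re, sub_im, mul_re, mul_im,
        conj_re, conj_im, smul_eq_mul]
      ring
    rw [this]
    positivity
  have i12 : CircleIntegrable (fun ζ => ‖h ζ‖ ^ 2 + ‖g ζ‖ ^ 2) 0 1 := i1.add i2
  have i123 : CircleIntegrable (fun ζ => ‖h ζ‖ ^ 2 + ‖g ζ‖ ^ 2 +
      (‖b (r * ζ)‖ ^ 2 + ‖a (r * ζ)‖ ^ 2) * ‖G ζ‖ ^ 2) 0 1 := i12.add i3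
  have j2 : CircleIntegrable (fun ζ => (2 : ℝ) • ((b (r * ζ) * G ζ * conj (h ζ)).re +
      (a (r * ζ) * G ζ * conj (g ζ)).re)) 0 1 := (jb'.add ja').const_smul
  rw [Real.circleAverage_fun_sub i123 j2,
    Real.circleAverage_fun_add i12 i3, Real.circleAverage_fun_add i1 i2,
    Real.circleAverage_fun_smul, Real.circleAverage_fun_add jb' ja', eb, ea] at hpos
  simpa using hpos

lemma circleAverage_norm_sq_eq {G : ℂ → ℂ} (hG : DiffContOnCl ℂ G (ball 0 1)) :
    Real.circleAverage (fun ζ => ‖G ζ‖ ^ 2) 0 1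
      = (Real.circleAverage (fun ζ => G ζ * conj (G ζ)) 0 1).re := by
  have := Complex.reCLM.circleAverage_comp_comm (circleIntegrable_mul_conj hG hG)
  change _ = Complex.re _ at this
  rw [← this]
  congr 1
  funext ζ
  exact (re_mul_conj_self _).symm

lemma szegoFun_self (w : ℂ) : szegoFun w w = ((1 / (1 - ‖w‖ ^ 2) : ℝ) : ℂ) := by
  rw [szegoFun, mul_comm, Complex.mul_conj, Complex.normSq_eq_norm_sq]
  push_cast
  rfl

lemma circleAverage_norm_sq_szegoFun {w : ℂ} (hw : ‖w‖ < 1) :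
    Real.circleAverage (fun ζ => ‖szegoFun w ζ‖ ^ 2) 0 1 = 1 / (1 - ‖w‖ ^ 2) := by
  have dw := diffContOnCl_szegoFun hw
  rw [circleAverage_norm_sq_eq dw, circleAverage_mul_conj_szegoFun dw hw, szegoFun_self,
    Complex.ofReal_re]

/-- The quadratic form of the de Branges--Rovnyak kernel dominates the evaluation at `l` of the
corresponding combination of Cauchy kernels. The proof uses that the row `[T_b̄, T_ā]` is
contractive, on vectors `(h + t k_l, -t e k_l)` with `e` chosen so that the two multiples of `k_l`
are sent to opposite functions. -/
lemma BoundaryData.norm_sq_le_dbrKernel_sum {b a : ℂ → ℂ} {k : ℂ → ℝ} (hd : BoundaryData b a k)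
    (hb : IsSchur b) (s : Finset 𝔻) (v : 𝔻 → ℂ) (l : 𝔻) :
    ‖∑ w ∈ s, v w * szegoFun w l‖ ^ 2 ≤
      (1 + ‖b l‖ ^ 2 / ‖a l‖ ^ 2) / (1 - ‖(l : ℂ)‖ ^ 2) *
        (∑ z ∈ s, ∑ w ∈ s, conj (v z) * v w * dbrKernel b z w).re := by
  have hl := l.norm_lt_one
  set h : ℂ → ℂ := fun ζ => ∑ w ∈ s, v w * szegoFun w ζ with hh
  set G : ℂ → ℂ := fun ζ => ∑ w ∈ s, (v w * conj (b w)) * szegoFun w ζ with hG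
  set e : ℂ := conj (b l) / conj (a l) with he
  have hane := hd.ne_zero hl
  have dh : DiffContOnCl ℂ h (ball 0 1) := diffContOnCl_sum s v
  have dG : DiffContOnCl ℂ G (ball 0 1) := diffContOnCl_sum s _
  have dl := diffContOnCl_szegoFun hl
  have ehh := circleAverage_mul_conj_sum dh s v
  have eGG := circleAverage_mul_conj_sum dG s (fun w => v w * conj (b w))
  have ehl := circleAverage_mul_conj_szegoFun dh hl
  set M : ℝ := (1 + ‖b l‖ ^ 2 / ‖a l‖ ^ 2) / (1 - ‖(l : ℂ)‖ ^ 2) with hM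
  have hM0 : 0 < M := by
    have := one_sub_norm_sq_pos hl
    positivity
  have nll := circleAverage_norm_sq_szegoFun hl
  have key : ∀ t : ℂ, Real.circleAverage (fun ζ => ‖G ζ‖ ^ 2) 0 1 ≤
      Real.circleAverage (fun ζ => ‖h ζ‖ ^ 2) 0 1 + 2 * (conj t * h l).re + ‖t‖ ^ 2 * M := by
    intro t
    -- The row sends `(h + t k_l, -t e k_l)` to `G`, whatever `t` is.
    have d1 : DiffContOnCl ℂ (fun ζ => h ζ + t * szegoFun l ζ) (ball 0 1) :=
      dh.add (dl.const_smul t)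
    have d2 : DiffContOnCl ℂ (fun ζ => -(t * e) * szegoFun l ζ) (ball 0 1) :=
      dl.const_smul (-(t * e))
    have hlim : Tendsto (fun r : ℝ =>
        Real.circleAverage (fun ζ => b (r * ζ) * G ζ * conj (h ζ + t * szegoFun l ζ)) 0 1 +
        Real.circleAverage (fun ζ => a (r * ζ) * G ζ * conj (-(t * e) * szegoFun l ζ)) 0 1)
        (𝓝[<] 1) (𝓝 (∑ w ∈ s, conj (v w) * (b w * G w))) := by
      have hl1 : Tendsto (fun r : ℝ => (∑ w ∈ s, conj (v w) * (b (r * w) * G w) +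
          conj t * (b (r * l) * G l)) + conj (-(t * e)) * (a (r * l) * G l)) (𝓝[<] 1)
          (𝓝 ((∑ w ∈ s, conj (v w) * (b w * G w) + conj t * (b l * G l)) +
            conj (-(t * e)) * (a l * G l))) := by
        refine ((tendsto_finsetSum _ fun w _ => ?_).add ?_).add ?_
        · exact ((tendsto_dilate hb.diff w.norm_lt_one).mul_const _).const_mul _
        · exact ((tendsto_dilate hb.diff hl).mul_const _).const_mul _
        · exact ((tendsto_dilate hd.diff hl).mul_const _).const_mul _
      have hval : (∑ w ∈ s, conj (v w) * (b w * G w) + conj t * (b l * G l)) +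
            conj (-(t * e)) * (a l * G l) = ∑ w ∈ s, conj (v w) * (b w * G w) := by
        simp only [he, map_neg, map_mul, map_div₀, Complex.conj_conj]
        field_simp
        ring
      rw [hval] at hl1
      refine hl1.congr' ?_
      filter_upwards [Ioo_mem_nhdsLT (zero_lt_one (α := ℝ))] with r hr
      have db := (diffContOnCl_dilate hb.diff hr).smul dG
      have da := (diffContOnCl_dilate hd.diff hr).smul dG
      have e1 := circleAverage_mul_conj_sum db s v
      have e2 := circleAverage_mul_conj_szegoFun db hl
      have e3 := circleAverage_mul_conj_szegoFun da hl
      simp only [smul_eq_mul] at e1 e2 e3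
      have f1 : (fun ζ => b (r * ζ) * G ζ * conj (h ζ + t * szegoFun l ζ)) =
          fun ζ => b (r * ζ) * G ζ * conj (h ζ) +
            conj t • (b (r * ζ) * G ζ * conj (szegoFun l ζ)) := by
        funext ζ
        simp only [map_add, map_mul, smul_eq_mul]
        ring
      have f2 : (fun ζ => a (r * ζ) * G ζ * conj (-(t * e) * szegoFun l ζ)) =
          fun ζ => conj (-(t * e)) • (a (r * ζ) * G ζ * conj (szegoFun l ζ)) := by
        funext ζ
        simp only [map_mul, smul_eq_mul]
        ring
      have g1 := circleIntegrable_mul_conj db dh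
      have g2 : CircleIntegrable
          (fun ζ => conj t • (b (r * ζ) * G ζ * conj (szegoFun l ζ))) 0 1 :=
        (circleIntegrable_mul_conj db dl).const_smul
      have e4 := Real.circleAverage_fun_add g1 g2
      simp only [smul_eq_mul] at e4
      have e5 := Real.circleAverage_fun_smul (a := conj t) (c := 0) (R := 1)
        (f := fun ζ => b (r * ζ) * G ζ * conj (szegoFun l ζ))
      simp only [smul_eq_mul] at e5
      rw [f1, f2, Real.circleAverage_fun_smul, e3]
      simp only [smul_eq_mul]
      rw [e4, e1, e5, e2]
    have hR := hd.two_re_le hb d1 d2 dG hlim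
    have hLG : (∑ w ∈ s, conj (v w) * (b w * G w)).re
        = Real.circleAverage (fun ζ => ‖G ζ‖ ^ 2) 0 1 := by
      rw [circleAverage_norm_sq_eq dG]
      change _ = (Real.circleAverage
        (fun ζ => G ζ * conj (∑ w ∈ s, (v w * conj (b w)) * szegoFun w ζ)) 0 1).re
      rw [eGG]
      congr 1
      refine Finset.sum_congr rfl fun w _ => ?_
      simp only [map_mul, Complex.conj_conj]
      ring
    have hn2 : Real.circleAverage (fun ζ => ‖-(t * e) * szegoFun l ζ‖ ^ 2) 0 1
        = ‖t‖ ^ 2 * (‖b l‖ ^ 2 / ‖a l‖ ^ 2) * (1 / (1 - ‖(l : ℂ)‖ ^ 2)) := by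
      rw [← nll]
      have := Real.circleAverage_fun_smul (a := ‖t * e‖ ^ 2) (c := 0) (R := 1)
        (f := fun ζ => ‖szegoFun l ζ‖ ^ 2)
      simp only [smul_eq_mul] at this
      simp only [norm_mul, norm_neg, mul_pow] at this ⊢
      rw [this, he, norm_div, norm_conj, norm_conj, div_pow]
    have hn1 : Real.circleAverage (fun ζ => ‖h ζ + t * szegoFun l ζ‖ ^ 2) 0 1
        = Real.circleAverage (fun ζ => ‖h ζ‖ ^ 2) 0 1 + 2 * (conj t * h l).re +
          ‖t‖ ^ 2 * (1 / (1 - ‖(l : ℂ)‖ ^ 2)) := by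
      have ji := circleIntegrable_mul_conj dh dl
      have i2 := ji.const_smul (a := 2 * conj t)
      have i2' : CircleIntegrable (fun ζ => ((2 * conj t) * (h ζ * conj (szegoFun l ζ))).re) 0 1 :=
        ⟨Integrable.re i2.1, Integrable.re i2.2⟩
      have i1 := circleIntegrable_norm_sq dh
      have i12 : CircleIntegrable
          (fun ζ => ‖h ζ‖ ^ 2 + ((2 * conj t) * (h ζ * conj (szegoFun l ζ))).re) 0 1 := i1.add i2'
      have i3 : CircleIntegrable (fun ζ => ‖t‖ ^ 2 • ‖szegoFun l ζ‖ ^ 2) 0 1 :=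
        (circleIntegrable_norm_sq dl).const_smul
      have f : (fun ζ => ‖h ζ + t * szegoFun l ζ‖ ^ 2) = fun ζ =>
          (‖h ζ‖ ^ 2 + ((2 * conj t) * (h ζ * conj (szegoFun l ζ))).re) +
            ‖t‖ ^ 2 • ‖szegoFun l ζ‖ ^ 2 := by
        funext ζ
        simp only [← Complex.normSq_eq_norm_sq, normSq_apply, add_re, add_im, mul_re, mul_im,
          conj_re, conj_im, smul_eq_mul, re_ofNat, im_ofNat]
        ring
      have ec := Complex.reCLM.circleAverage_comp_comm i2
      change Real.circleAverage (fun ζ => ((2 * conj t) * (h ζ * conj (szegoFun l ζ))).re) 0 1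
        = Complex.re _ at ec
      rw [f, Real.circleAverage_fun_add i12 i3, Real.circleAverage_fun_add i1 i2', ec,
        Real.circleAverage_fun_smul, Real.circleAverage_smul, ehl, nll]
      simp only [smul_eq_mul]
      rw [mul_assoc, show ∀ x : ℂ, (2 * x).re = 2 * x.re from fun x => by simp]
    rw [hn1, hn2, hLG] at hR
    have : ‖t‖ ^ 2 * M = ‖t‖ ^ 2 * (1 / (1 - ‖(l : ℂ)‖ ^ 2)) +
        ‖t‖ ^ 2 * (‖b l‖ ^ 2 / ‖a l‖ ^ 2) * (1 / (1 - ‖(l : ℂ)‖ ^ 2)) := by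
      rw [hM]; ring
    linarith
  have hQ : (∑ z ∈ s, ∑ w ∈ s, conj (v z) * v w * dbrKernel b z w).re =
      Real.circleAverage (fun ζ => ‖h ζ‖ ^ 2) 0 1 -
        Real.circleAverage (fun ζ => ‖G ζ‖ ^ 2) 0 1 := by
    rw [circleAverage_norm_sq_eq dh, circleAverage_norm_sq_eq dG, ← Complex.sub_re]
    change _ = (Real.circleAverage (fun ζ => h ζ * conj (∑ w ∈ s, v w * szegoFun w ζ)) 0 1 -
      Real.circleAverage
        (fun ζ => G ζ * conj (∑ w ∈ s, (v w * conj (b w)) * szegoFun w ζ)) 0 1).re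
    rw [ehh, eGG, ← Finset.sum_sub_distrib]
    congr 1
    refine Finset.sum_congr rfl fun z _ => ?_
    rw [hh, hG]
    simp only [Finset.mul_sum]
    rw [← Finset.sum_sub_distrib]
    refine Finset.sum_congr rfl fun w _ => ?_
    simp only [dbrKernel, szegoFun, mul_comm (conj (w : ℂ)), map_mul, Complex.conj_conj]
    ring
  rw [hQ]
  -- The optimal value of the quadratic polynomial in `t`.
  have hopt := key (-(h l / M))
  have h1 : (conj (-(h l / M)) * h l).re = -(‖h l‖ ^ 2 / M) := by
    have : conj (-(h l / M)) * h l = ((-(‖h l‖ ^ 2 / M) : ℝ) : ℂ) := by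
      rw [map_neg, map_div₀, Complex.conj_ofReal, ← Complex.normSq_eq_norm_sq]
      push_cast
      rw [← Complex.mul_conj]
      ring
    rw [this, Complex.ofReal_re]
  have h2 : ‖-(h l / (M : ℂ))‖ ^ 2 * M = ‖h l‖ ^ 2 / M := by
    rw [norm_neg, norm_div, Complex.norm_real, Real.norm_of_nonneg hM0.le]
    field_simp
  rw [h1, h2] at hopt
  have h3 : ‖h l‖ ^ 2 / M ≤ Real.circleAverage (fun ζ => ‖h ζ‖ ^ 2) 0 1 -
        Real.circleAverage (fun ζ => ‖G ζ‖ ^ 2) 0 1 := by linarith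
  rw [div_le_iff₀ hM0] at h3
  linarith

/-! ### Point evaluations and norms in `H(b)` -/

/-- The extension by zero to the plane of a function on the disc. -/
def discExtend (g : 𝔻 → ℂ) (z : ℂ) : ℂ :=
  if h : ‖z‖ < 1 then g (UnitDisc.mk z h) else 0

lemma discExtend_coe (g : 𝔻 → ℂ) (z : 𝔻) : discExtend g z = g z := by
  rw [discExtend, dif_pos z.norm_lt_one, UnitDisc.mk_coe]

lemma discExtend_add (f g : 𝔻 → ℂ) : discExtend (f + g) = discExtend f + discExtend g := by
  funext z
  by_cases h : ‖z‖ < 1 <;> simp [discExtend, h]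

lemma discExtend_smul (c : ℂ) (g : 𝔻 → ℂ) : discExtend (c • g) = c • discExtend g := by
  funext z
  by_cases h : ‖z‖ < 1 <;> simp [discExtend, h]

lemma norm_dbrKernel_self {b : ℂ → ℂ} (hb : IsSchur b) (z : 𝔻) :
    ‖dbrKernel b z z‖ = (1 - ‖b z‖ ^ 2) / (1 - ‖(z : ℂ)‖ ^ 2) := by
  have h1 := one_sub_norm_sq_pos z.norm_lt_one
  have h2 : ‖b z‖ ^ 2 ≤ 1 :=
    pow_le_one₀ (norm_nonneg _) (hb.bound z (by simpa using z.norm_lt_one))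
  have : dbrKernel b z z = (((1 - ‖b z‖ ^ 2) / (1 - ‖(z : ℂ)‖ ^ 2) : ℝ) : ℂ) := by
    rw [dbrKernel, Complex.mul_conj, Complex.mul_conj, Complex.normSq_eq_norm_sq,
      Complex.normSq_eq_norm_sq]
    push_cast
    rfl
  rw [this, Complex.norm_real, Real.norm_of_nonneg]
  exact div_nonneg (sub_nonneg.mpr h2) h1.le

section Kernel

variable {b : ℂ → ℂ} [Fact (dbrMatrix b).PosSemidef]

/-- Evaluation at `z` on `H(b)` has squared norm `(1 - |b(z)|²) / (1 - |z|²)`. -/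
lemma norm_sq_apply_le (hb : IsSchur b) (g : RKHS.OfKernel (dbrMatrix b)) (z : 𝔻) :
    ‖g z‖ ^ 2 ≤ ‖g‖ ^ 2 * ((1 - ‖b z‖ ^ 2) / (1 - ‖(z : ℂ)‖ ^ 2)) := by
  have h := RKHS.norm_apply_le g z
  rw [RKHS.OfKernel.kernel_ofKernel] at h
  have h1 : ‖dbrMatrix b z z‖ = (1 - ‖b z‖ ^ 2) / (1 - ‖(z : ℂ)‖ ^ 2) := by
    rw [← norm_dbrKernel_self hb]
    simp [dbrMatrix, norm_smul]
  rw [h1] at h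
  have h2 := pow_le_pow_left₀ (norm_nonneg _) h 2
  rwa [mul_pow, Real.sq_sqrt] at h2
  rw [← h1]
  exact norm_nonneg _

/-- A bound for the norm in `H(b)`, tested against the dense span of the kernel functions. -/
lemma norm_sq_le_of_forall_sum (g : RKHS.OfKernel (dbrMatrix b)) {M : ℝ} (hM : 0 ≤ M)
    (h : ∀ (s : Finset 𝔻) (v : 𝔻 → ℂ), ‖∑ w ∈ s, conj (v w) * g w‖ ^ 2 ≤
      M * (∑ z ∈ s, ∑ w ∈ s, conj (v z) * v w * dbrKernel b z w).re) :
    ‖g‖ ^ 2 ≤ M := by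
  set K : 𝔻 → RKHS.OfKernel (dbrMatrix b) :=
    fun w => RKHS.kerFun (RKHS.OfKernel (dbrMatrix b)) w (1 : ℂ) with hK
  have hdense : Dense (Submodule.span ℂ (range K) : Set (RKHS.OfKernel (dbrMatrix b))) := by
    rw [Submodule.dense_iff_topologicalClosure_eq_top, eq_top_iff,
      ← RKHS.kerFun_dense (RKHS.OfKernel (dbrMatrix b))]
    refine Submodule.topologicalClosure_mono (Submodule.span_le.mpr ?_)
    rintro _ ⟨w, v, rfl⟩
    have : RKHS.kerFun (RKHS.OfKernel (dbrMatrix b)) w v = v • K w := by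
      rw [hK, ← map_smul, smul_eq_mul, mul_one]
    rw [this]
    exact Submodule.smul_mem _ _ (Submodule.subset_span ⟨w, rfl⟩)
  have hsum : ∀ x ∈ (Submodule.span ℂ (range K) : Set (RKHS.OfKernel (dbrMatrix b))),
      ‖⟪x, g⟫_ℂ‖ ^ 2 ≤ M * ‖x‖ ^ 2 := by
    intro x hx
    rw [SetLike.mem_coe, ← Finsupp.range_linearCombination] at hx
    obtain ⟨v, rfl⟩ := hx
    have hx : Finsupp.linearCombination ℂ K v = ∑ w ∈ v.support, v w • K w := rfl
    have h1 : ⟪Finsupp.linearCombination ℂ K v, g⟫_ℂ = ∑ w ∈ v.support, conj (v w) * g w := by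
      rw [hx, sum_inner]
      refine Finset.sum_congr rfl fun w _ => ?_
      rw [inner_smul_left, hK, RKHS.kerFun_inner]
      simp
    have h2 : ‖Finsupp.linearCombination ℂ K v‖ ^ 2 =
        (∑ z ∈ v.support, ∑ w ∈ v.support, conj (v z) * v w * dbrKernel b z w).re := by
      rw [← inner_self_eq_norm_sq (𝕜 := ℂ), hx, sum_inner]
      change Complex.re _ = _
      congr 1
      refine Finset.sum_congr rfl fun z _ => ?_
      rw [inner_sum]
      refine Finset.sum_congr rfl fun w _ => ?_
      rw [inner_smul_left, inner_smul_right, hK, RKHS.kerFun_inner, RKHS.kerFun_apply,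
        RKHS.OfKernel.kernel_ofKernel]
      simp [dbrMatrix, mul_assoc]
    rw [h1, h2]
    exact h _ _
  have hall : ∀ x, ‖⟪x, g⟫_ℂ‖ ^ 2 ≤ M * ‖x‖ ^ 2 := by
    intro x
    refine hdense.induction hsum ?_ x
    exact isClosed_le (by fun_prop) (by fun_prop)
  have hg := hall g
  rw [inner_self_eq_norm_sq_to_K] at hg
  by_cases h0 : ‖g‖ = 0
  · rw [h0]
    simpa using hM
  · have hp : 0 < ‖g‖ ^ 2 := by positivity
    simp only [norm_pow, coe_algebraMap, Complex.norm_real, norm_norm] at hg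
    nlinarith

lemma norm_sq_le_of_eq_szegoFun {a : ℂ → ℂ} {k : ℂ → ℝ} (hd : BoundaryData b a k)
    (hb : IsSchur b) (l : 𝔻) (g : RKHS.OfKernel (dbrMatrix b)) (hg : ∀ z : 𝔻, g z = szegoFun l z) :
    ‖g‖ ^ 2 ≤ (1 + ‖b l‖ ^ 2 / ‖a l‖ ^ 2) / (1 - ‖(l : ℂ)‖ ^ 2) := by
  have hl := one_sub_norm_sq_pos l.norm_lt_one
  refine norm_sq_le_of_forall_sum g (by positivity) fun s v => ?_
  refine le_trans (le_of_eq ?_) (hd.norm_sq_le_dbrKernel_sum hb s v l)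
  rw [← norm_conj, map_sum]
  congr 2
  refine Finset.sum_congr rfl fun w _ => ?_
  rw [hg]
  simp [szegoFun, mul_comm]

/-- Evaluation of the derivative at a point of the disc is bounded on `H(b)`. -/
lemma norm_deriv_discExtend_le (hb : IsSchur b)
    (hdiff : ∀ g : RKHS.OfKernel (dbrMatrix b), DifferentiableOn ℂ (discExtend g) (ball 0 1))
    {z : ℂ} (hz : ‖z‖ < 1) :
    ∃ C, ∀ g : RKHS.OfKernel (dbrMatrix b), ‖deriv (discExtend g) z‖ ≤ C * ‖g‖ := by
  set R : ℝ := (1 - ‖z‖) / 2 with hR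
  have hR0 : 0 < R := by linarith
  refine ⟨√(1 / R) / R, fun g => ?_⟩
  have hmem : ∀ w ∈ closedBall z R, ‖w‖ ≤ 1 - R := by
    intro w hw
    rw [mem_closedBall, dist_eq_norm] at hw
    have := norm_le_norm_add_norm_sub' w z
    linarith
  have hsub : closedBall z R ⊆ ball (0 : ℂ) 1 := fun w hw => by
    have := hmem w hw
    rw [mem_ball_zero_iff]; linarith
  have hdc : DiffContOnCl ℂ (discExtend g) (ball z R) := by
    apply DifferentiableOn.diffContOnCl
    rw [closure_ball z hR0.ne']
    exact (hdiff g).mono hsub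
  have := Complex.norm_deriv_le_of_forall_mem_sphere_norm_le (C := √(1 / R) * ‖g‖) hR0 hdc ?_
  · calc _ ≤ _ := this
      _ = _ := by ring
  · intro w hw
    have hw1 := hmem w (sphere_subset_closedBall hw)
    have hlt : ‖w‖ < 1 := by linarith
    have h1 := norm_sq_apply_le hb g (UnitDisc.mk w hlt)
    have h2 : discExtend g w = g (UnitDisc.mk w hlt) := by rw [discExtend, dif_pos hlt]
    rw [h2]
    refine abs_le_of_sq_le_sq' ?_ (by positivity) |>.2
    rw [mul_pow, Real.sq_sqrt (by positivity), mul_comm]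
    refine h1.trans ?_
    have h3 : R ≤ 1 - ‖w‖ ^ 2 := by nlinarith [norm_nonneg w]
    have h4 : 1 - ‖b w‖ ^ 2 ≤ 1 := by linarith [sq_nonneg ‖b w‖]
    have h5 : 0 < 1 - ‖w‖ ^ 2 := one_sub_norm_sq_pos hlt
    simp only [UnitDisc.coe_mk]
    gcongr

end Kernel

/-- A lower semicontinuous quadratic gauge that is finite on a whole Banach space is bounded on it,
by Baire's theorem. -/
lemma exists_quadratic_bound {E : Type*} [NormedAddCommGroup E] [NormedSpace ℂ E] [CompleteSpace E]
    (p : E → ℝ≥0∞) (hclosed : ∀ n : ℕ, IsClosed {x | p x ≤ n})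
    (hadd : ∀ x y, p (x + y) ≤ 2 * (p x + p y)) (hsmul : ∀ (c : ℂ) x, p (c • x) = ‖c‖ₑ ^ 2 * p x)
    (hfin : ∀ x, p x < ∞) : ∃ C : ℝ, ∀ x, p x ≤ ENNReal.ofReal (C * ‖x‖ ^ 2) := by
  have hU : ⋃ n : ℕ, {x | p x ≤ n} = univ := by
    refine eq_univ_of_forall fun x => mem_iUnion.mpr ?_
    obtain ⟨n, hn⟩ := ENNReal.exists_nat_gt (hfin x).ne
    exact ⟨n, hn.le⟩
  obtain ⟨n, x₀, hx₀⟩ := nonempty_interior_of_iUnion_of_closed hclosed hU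
  obtain ⟨ε, hε, hball⟩ := Metric.isOpen_iff.mp isOpen_interior x₀ hx₀
  have hball' : ∀ x ∈ ball x₀ ε, p x ≤ n := fun x hx => by
    simpa using interior_subset (hball hx)
  have hsmall : ∀ y, ‖y‖ < ε → p y ≤ 4 * n := by
    intro y hy
    have e : y = (x₀ + y) + (-1 : ℂ) • x₀ := by simp
    calc p y = p ((x₀ + y) + (-1 : ℂ) • x₀) := by rw [← e]
      _ ≤ 2 * (p (x₀ + y) + p ((-1 : ℂ) • x₀)) := hadd _ _
      _ ≤ 2 * (n + n) := by
          gcongr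
          · exact hball' _ (by simpa using hy)
          · rw [hsmul]
            simpa using hball' x₀ (mem_ball_self hε)
      _ = 4 * n := by ring
  refine ⟨16 * n / ε ^ 2, fun x => ?_⟩
  by_cases hx : x = 0
  · subst hx
    have := hsmul 0 0
    simp at this
    simp [this]
  · have hx0 : 0 < ‖x‖ := norm_pos_iff.mpr hx
    set c : ℝ := ε / (2 * ‖x‖) with hc
    have hc0 : 0 < c := by positivity
    have h1 := hsmall ((c : ℂ) • x) (by
      rw [norm_smul, Complex.norm_real, Real.norm_of_nonneg hc0.le, hc]
      field_simp
      norm_num)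
    rw [hsmul, ← ofReal_norm, Complex.norm_real, Real.norm_of_nonneg hc0.le,
      ← ENNReal.ofReal_pow hc0.le] at h1
    calc p x = ENNReal.ofReal ((c ^ 2)⁻¹) * (ENNReal.ofReal (c ^ 2) * p x) := by
          rw [← mul_assoc, ← ENNReal.ofReal_mul (by positivity),
            inv_mul_cancel₀ (by positivity), ENNReal.ofReal_one, one_mul]
      _ ≤ ENNReal.ofReal ((c ^ 2)⁻¹) * (4 * n) := by gcongr
      _ = ENNReal.ofReal ((c ^ 2)⁻¹ * (4 * n)) := by
          rw [ENNReal.ofReal_mul (by positivity), ENNReal.ofReal_mul (by positivity)]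
          simp
      _ = _ := by
          congr 1
          rw [hc]
          field_simp
          ring

lemma measurable_dirichlet_integrand (μ : Measure Circle) [IsFiniteMeasure μ] (f : ℂ → ℂ) :
    Measurable fun z => ‖deriv f z‖ₑ ^ 2 * ENNReal.ofReal (poissonIntegral μ z) :=
  ((measurable_deriv f).enorm.pow_const 2).mul (measurable_poissonIntegral μ).ennreal_ofReal

lemma dirichletIntegral_const_smul (μ : Measure Circle) [IsFiniteMeasure μ] (c : ℂ) (f : ℂ → ℂ) :
    dirichletIntegral μ (c • f) = ‖c‖ₑ ^ 2 * dirichletIntegral μ f := by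
  simp only [dirichletIntegral_eq]
  rw [mul_left_comm, ← lintegral_const_mul (‖c‖ₑ ^ 2) (measurable_dirichlet_integrand μ f)]
  congr 2
  funext z
  rw [deriv_const_smul_field, enorm_smul, mul_pow, mul_assoc]

lemma dirichletIntegral_congr (μ : Measure Circle) {f g : ℂ → ℂ} (h : EqOn f g (ball 0 1)) :
    dirichletIntegral μ f = dirichletIntegral μ g := by
  unfold dirichletIntegral
  congr 1
  refine setLIntegral_congr_fun measurableSet_ball fun z hz => ?_
  rw [(h.eventuallyEq_of_mem (isOpen_ball.mem_nhds hz)).deriv_eq]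

section Embedding

variable {b : ℂ → ℂ} [Fact (dbrMatrix b).PosSemidef]

/-- If `H(b)` is contained in the harmonically weighted Dirichlet space, the inclusion is bounded. -/
lemma exists_dirichletIntegral_le (hb : IsSchur b) {μ : Measure Circle} [IsFiniteMeasure μ]
    (hmem : ∀ g : RKHS.OfKernel (dbrMatrix b), discExtend g ∈ harmonicDirichlet μ) :
    ∃ C : ℝ, ∀ g : RKHS.OfKernel (dbrMatrix b),
      dirichletIntegral μ (discExtend g) ≤ ENNReal.ofReal (C * ‖g‖ ^ 2) := by
  have hdiff : ∀ g : RKHS.OfKernel (dbrMatrix b),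
      DifferentiableOn ℂ (discExtend g) (ball 0 1) := fun g => (hmem g).1.1
  have hda : ∀ (g : RKHS.OfKernel (dbrMatrix b)) {z : ℂ}, z ∈ ball (0 : ℂ) 1 →
      DifferentiableAt ℂ (discExtend g) z := fun g z hz =>
    (hdiff g).differentiableAt (isOpen_ball.mem_nhds hz)
  have hm := measurable_dirichlet_integrand μ
  refine exists_quadratic_bound (fun g : RKHS.OfKernel (dbrMatrix b) =>
    dirichletIntegral μ (discExtend g)) ?_ ?_ ?_
    fun g => (hmem g).2
  · -- Closedness of the sublevel sets is Fatou's lemma, as `g ↦ g'(z)` is continuous.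
    intro n
    refine IsSeqClosed.isClosed fun u x hu hux => ?_
    have hlim : ∀ z ∈ ball (0 : ℂ) 1, Tendsto (fun j => deriv (discExtend (u j)) z) atTop
        (𝓝 (deriv (discExtend x) z)) := by
      intro z hz
      obtain ⟨C, hC⟩ := norm_deriv_discExtend_le hb hdiff (mem_ball_zero_iff.mp hz)
      rw [tendsto_iff_norm_sub_tendsto_zero] at hux ⊢
      refine squeeze_zero (fun _ => norm_nonneg _) (fun j => ?_) (by simpa using hux.const_mul C)
      have e : u j = (u j - x) + x := by abel
      have h1 := discExtend_add (⇑(u j - x)) (⇑x)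
      rw [← RKHS.coe_add, ← e] at h1
      have h2 : deriv (discExtend (u j)) z = deriv (discExtend ⇑(u j - x)) z
          + deriv (discExtend x) z := by
        rw [h1, deriv_add (hda _ hz) (hda _ hz)]
      rw [h2, add_sub_cancel_right]
      exact hC _
    simp only [mem_ofPred_eq, dirichletIntegral_eq] at hu ⊢
    calc _ ≤ ENNReal.ofReal (1 / Real.pi) * liminf (fun j => ∫⁻ z in ball (0 : ℂ) 1,
          ‖deriv (discExtend (u j)) z‖ₑ ^ 2 * ENNReal.ofReal (poissonIntegral μ z)) atTop := by
          gcongr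
          refine le_trans ?_ (lintegral_liminf_le fun j => hm _)
          refine setLIntegral_mono' measurableSet_ball fun z hz => ?_
          apply le_of_eq
          symm
          apply Tendsto.liminf_eq
          exact ENNReal.Tendsto.mul_const
            (((ENNReal.continuous_pow 2).tendsto _).comp (hlim z hz).enorm)
            (.inr ENNReal.ofReal_ne_top)
      _ = liminf (fun j => ENNReal.ofReal (1 / Real.pi) * ∫⁻ z in ball (0 : ℂ) 1,
          ‖deriv (discExtend (u j)) z‖ₑ ^ 2 * ENNReal.ofReal (poissonIntegral μ z)) atTop :=
          (ENNReal.liminf_const_mul_of_ne_top ENNReal.ofReal_ne_top).symm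
      _ ≤ n := by
          refine liminf_le_of_le (by isBoundedDefault) fun c hc => ?_
          obtain ⟨j, hj⟩ := hc.exists
          exact hj.trans (hu j)
  · intro x y
    simp only [dirichletIntegral_eq, RKHS.coe_add, discExtend_add]
    have hxy : Measurable fun z =>
        ‖deriv (discExtend x) z‖ₑ ^ 2 * ENNReal.ofReal (poissonIntegral μ z) +
          ‖deriv (discExtend y) z‖ₑ ^ 2 * ENNReal.ofReal (poissonIntegral μ z) :=
      (hm _).add (hm _)
    rw [← mul_add, ← lintegral_add_left (hm _), mul_left_comm, ← lintegral_const_mul 2 hxy]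
    refine mul_le_mul' le_rfl ?_
    refine setLIntegral_mono' measurableSet_ball fun z hz => ?_
    rw [← add_mul, ← mul_assoc]
    gcongr
    rw [deriv_add (hda _ hz) (hda _ hz)]
    simp only [← ofReal_norm, ← ENNReal.ofReal_pow (norm_nonneg _)]
    rw [← ENNReal.ofReal_add (by positivity) (by positivity), show (2 : ℝ≥0∞) = ENNReal.ofReal 2 by
      simp, ← ENNReal.ofReal_mul (by positivity)]
    apply ENNReal.ofReal_le_ofReal
    have := pow_le_pow_left₀ (norm_nonneg _)
      (norm_add_le (deriv (discExtend x) z) (deriv (discExtend y) z)) 2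
    nlinarith [sq_nonneg (‖deriv (discExtend x) z‖ - ‖deriv (discExtend y) z‖)]
  · intro c x
    simp only [RKHS.coe_smul, discExtend_smul]
    exact dirichletIntegral_const_smul μ c _

end Embedding

/-! ### Bounded sequences of the Dirichlet space in `H(b)` -/

/-- Cauchy--Schwarz with weights `|c n|`. -/
lemma enorm_sq_le_of_hasSum {c v : ℕ → ℂ} {S : ℂ} (h : HasSum (fun n => c n * v n) S) :
    ‖S‖ₑ ^ 2 ≤ (∑' n, ‖c n‖ₑ) * ∑' n, ‖c n‖ₑ * ‖v n‖ₑ ^ 2 := by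
  have hlim : Tendsto (fun s : Finset ℕ => ‖∑ n ∈ s, c n * v n‖ₑ ^ 2) atTop (𝓝 (‖S‖ₑ ^ 2)) :=
    ((ENNReal.continuous_pow 2).tendsto _).comp (Tendsto.enorm h)
  refine le_of_tendsto' hlim fun s => ?_
  calc ‖∑ n ∈ s, c n * v n‖ₑ ^ 2 ≤ (∑ n ∈ s, ‖c n‖ₑ) * ∑ n ∈ s, ‖c n‖ₑ * ‖v n‖ₑ ^ 2 := by
        have h1 : (∑ n ∈ s, ‖c n‖ * ‖v n‖) ^ 2 ≤ (∑ n ∈ s, ‖c n‖) * ∑ n ∈ s, ‖c n‖ * ‖v n‖ ^ 2 :=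
          Finset.sum_sq_le_sum_mul_sum_of_sq_le_mul s (fun _ _ => norm_nonneg _)
            (fun _ _ => by positivity) (fun _ _ => le_of_eq (by ring))
        have h2 : ‖∑ n ∈ s, c n * v n‖ ^ 2 ≤ (∑ n ∈ s, ‖c n‖ * ‖v n‖) ^ 2 := by
          refine pow_le_pow_left₀ (norm_nonneg _) ((norm_sum_le _ _).trans ?_) 2
          exact Finset.sum_le_sum fun n _ => (norm_mul _ _).le
        have h3 := ENNReal.ofReal_le_ofReal (h2.trans h1)
        rw [ENNReal.ofReal_pow (norm_nonneg _), ENNReal.ofReal_mul (by positivity),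
          ENNReal.ofReal_sum_of_nonneg fun _ _ => norm_nonneg _,
          ENNReal.ofReal_sum_of_nonneg fun _ _ => by positivity] at h3
        simpa only [ENNReal.ofReal_mul (norm_nonneg _), ENNReal.ofReal_pow (norm_nonneg _),
          ofReal_norm] using h3
    _ ≤ _ := by
        gcongr
        · exact ENNReal.sum_le_tsum s
        · exact ENNReal.sum_le_tsum s

lemma lintegral_enorm_sq_le_of_hasSum {X : Type*} [MeasurableSpace X] {ν : Measure X} {c : ℕ → ℂ}
    {v : ℕ → X → ℂ} (hv : ∀ n, AEMeasurable (v n) ν) {S : X → ℂ}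
    (hS : ∀ᵐ x ∂ν, HasSum (fun n => c n * v n x) (S x)) {K : ℝ≥0∞}
    (hK : ∀ n, ∫⁻ x, ‖v n x‖ₑ ^ 2 ∂ν ≤ K) :
    ∫⁻ x, ‖S x‖ₑ ^ 2 ∂ν ≤ (∑' n, ‖c n‖ₑ) ^ 2 * K := by
  have hm : ∀ n, AEMeasurable (fun x => ‖v n x‖ₑ ^ 2) ν := fun n => (hv n).enorm.pow_const 2
  calc ∫⁻ x, ‖S x‖ₑ ^ 2 ∂ν ≤ ∫⁻ x, (∑' n, ‖c n‖ₑ) * ∑' n, ‖c n‖ₑ * ‖v n x‖ₑ ^ 2 ∂ν :=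
        lintegral_mono_ae (hS.mono fun x hx => enorm_sq_le_of_hasSum hx)
    _ = (∑' n, ‖c n‖ₑ) * ∑' n, ‖c n‖ₑ * ∫⁻ x, ‖v n x‖ₑ ^ 2 ∂ν := by
        rw [lintegral_const_mul'' _ (AEMeasurable.tsum fun n => (hm n).const_mul _),
          lintegral_tsum fun n => (hm n).const_mul _]
        congr 2
        funext n
        exact lintegral_const_mul'' _ (hm n)
    _ ≤ (∑' n, ‖c n‖ₑ) * ∑' n, ‖c n‖ₑ * K := by
        gcongr with n
        exact hK n
    _ = _ := by rw [ENNReal.tsum_mul_right]; ring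

/-- Functions uniformly bounded in the Hardy space and in the harmonically weighted Dirichlet
space, together with the pointwise bound that the former implies. -/
structure UniformlyDirichlet (μ : Measure Circle) (u : ℕ → ℂ → ℂ) (K : ℝ) : Prop where
  diff : ∀ n, DifferentiableOn ℂ (u n) (ball 0 1)
  bound : ∀ n z, ‖z‖ < 1 → ‖u n z‖ ≤ 1 / (1 - ‖z‖)
  hardy : ∀ n, ∀ r ∈ Ioo (0 : ℝ) 1, Real.circleAverage (fun z => ‖u n z‖ ^ 2) 0 r ≤ 1
  dirichlet : ∀ n, dirichletIntegral μ (u n) ≤ ENNReal.ofReal K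

lemma ofReal_circleAverage_norm_sq {f : ℂ → ℂ} (hf : DifferentiableOn ℂ f (ball 0 1)) {r : ℝ}
    (hr : r ∈ Ioo (0 : ℝ) 1) :
    ENNReal.ofReal (Real.circleAverage (fun z => ‖f z‖ ^ 2) 0 r) =
      ENNReal.ofReal (2 * Real.pi)⁻¹ *
        ∫⁻ θ in Ioc (0 : ℝ) (2 * Real.pi), ‖f (circleMap 0 r θ)‖ₑ ^ 2 := by
  have hπ := Real.pi_pos
  have hc : Continuous fun θ : ℝ => f (circleMap 0 r θ) := by
    refine hf.continuousOn.comp_continuous (continuous_circleMap 0 r) fun θ => ?_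
    simpa [abs_of_pos hr.1] using hr.2
  have hi : IntegrableOn (fun θ : ℝ => ‖f (circleMap 0 r θ)‖ ^ 2) (Ioc 0 (2 * Real.pi)) :=
    ((hc.norm.pow 2).intervalIntegrable (μ := volume) 0 (2 * Real.pi)).1
  rw [Real.circleAverage_def, smul_eq_mul, ENNReal.ofReal_mul (by positivity),
    intervalIntegral.integral_of_le (by positivity),
    ofReal_integral_eq_lintegral_ofReal hi (.of_forall fun θ => by positivity)]
  simp only [ENNReal.ofReal_pow (norm_nonneg _), ofReal_norm]

lemma summable_lp_one (c : lp (fun _ : ℕ => ℂ) 1) : Summable fun n => ‖c n‖ := by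
  simpa using (lp.memℓp c).summable (by norm_num)

lemma norm_lp_one (c : lp (fun _ : ℕ => ℂ) 1) : ‖c‖ = ∑' n, ‖c n‖ := by
  simpa using lp.norm_eq_tsum_rpow (p := 1) (by norm_num) c

namespace UniformlyDirichlet

variable {μ : Measure Circle} {u : ℕ → ℂ → ℂ} {K : ℝ}

lemma summable (hu : UniformlyDirichlet μ u K) {c : ℕ → ℂ} (hc : Summable fun n => ‖c n‖) {z : ℂ}
    (hz : ‖z‖ < 1) : Summable fun n => c n * u n z := by
  refine Summable.of_norm_bounded (hc.mul_right (1 / (1 - ‖z‖))) fun n => ?_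
  rw [norm_mul]
  gcongr
  exact hu.bound n z hz

lemma differentiableOn_tsum_and_hasSum (hu : UniformlyDirichlet μ u K) {c : ℕ → ℂ}
    (hc : Summable fun n => ‖c n‖) :
    DifferentiableOn ℂ (fun z => ∑' n, c n * u n z) (ball 0 1) ∧
    ∀ z ∈ ball (0 : ℂ) 1, HasSum (fun n => c n * deriv (u n) z)
      (deriv (fun z => ∑' n, c n * u n z) z) := by
  have key : ∀ z ∈ ball (0 : ℂ) 1,
      DifferentiableAt ℂ (fun z => ∑' n, c n * u n z) z ∧
      HasSum (fun n => c n * deriv (u n) z) (deriv (fun z => ∑' n, c n * u n z) z) := by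
    intro z hz
    rw [mem_ball_zero_iff] at hz
    obtain ⟨ρ, hzρ, hρ⟩ := exists_between hz
    have hsub : ball (0 : ℂ) ρ ⊆ ball 0 1 := ball_subset_ball hρ.le
    have hd : ∀ n, DifferentiableOn ℂ (fun z => c n * u n z) (ball 0 ρ) := fun n =>
      ((hu.diff n).mono hsub).const_mul (c n)
    have hle : ∀ n, ∀ w ∈ ball (0 : ℂ) ρ, ‖c n * u n w‖ ≤ ‖c n‖ * (1 / (1 - ρ)) := by
      intro n w hw
      rw [mem_ball_zero_iff] at hw
      rw [norm_mul]
      gcongr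
      refine (hu.bound n w (hw.trans hρ)).trans ?_
      have : 0 < 1 - ρ := by linarith
      gcongr
    have hsum := hc.mul_right (1 / (1 - ρ))
    have hzm : z ∈ ball (0 : ℂ) ρ := by simpa using hzρ
    refine ⟨(differentiableOn_tsum_of_summable_norm hsum hd isOpen_ball hle).differentiableAt
      (isOpen_ball.mem_nhds hzm), ?_⟩
    have := hasSum_deriv_of_summable_norm hsum hd isOpen_ball hle hzm
    simpa only [deriv_const_mul_field'] using this
  exact ⟨fun z hz => (key z hz).1.differentiableWithinAt, fun z hz => (key z hz).2⟩

/-- `ℓ¹` combinations of the sequence belong to the harmonically weighted Dirichlet space. -/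
lemma tsum_mem [IsFiniteMeasure μ] (hu : UniformlyDirichlet μ u K) {c : ℕ → ℂ}
    (hc : Summable fun n => ‖c n‖) : (fun z => ∑' n, c n * u n z) ∈ harmonicDirichlet μ := by
  obtain ⟨hdiff, hder⟩ := hu.differentiableOn_tsum_and_hasSum hc
  have hA : ∑' n, ‖c n‖ₑ ≠ ∞ := by
    simp only [← ofReal_norm]
    exact hc.tsum_ofReal_ne_top
  have hπ := Real.pi_pos
  refine ⟨⟨hdiff, ((∑' n, ‖c n‖ₑ) ^ 2).toReal, fun r hr => ?_⟩, ?_⟩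
  · rw [← ENNReal.ofReal_le_iff_le_toReal (by finiteness), ofReal_circleAverage_norm_sq hdiff hr]
    have hcirc : ∀ θ, ‖circleMap 0 r θ‖ < 1 := fun θ => by simpa [abs_of_pos hr.1] using hr.2
    have hv : ∀ n, AEMeasurable (fun θ => u n (circleMap 0 r θ))
        (volume.restrict (Ioc (0 : ℝ) (2 * Real.pi))) := fun n =>
      ((hu.diff n).continuousOn.comp_continuous (continuous_circleMap 0 r)
        fun θ => by simpa using hcirc θ).aemeasurable
    have hne : ENNReal.ofReal (2 * Real.pi)⁻¹ * ENNReal.ofReal (2 * Real.pi) = 1 := by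
      rw [← ENNReal.ofReal_mul (by positivity), inv_mul_cancel₀ (by positivity),
        ENNReal.ofReal_one]
    have hK : ∀ n, ∫⁻ θ in Ioc (0 : ℝ) (2 * Real.pi), ‖u n (circleMap 0 r θ)‖ₑ ^ 2 ≤
        ENNReal.ofReal (2 * Real.pi) := by
      intro n
      have h1 := ENNReal.ofReal_le_ofReal (hu.hardy n r hr)
      rw [ofReal_circleAverage_norm_sq (hu.diff n) hr, ENNReal.ofReal_one] at h1
      calc _ = ENNReal.ofReal (2 * Real.pi) * (ENNReal.ofReal (2 * Real.pi)⁻¹ *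
            ∫⁻ θ in Ioc (0 : ℝ) (2 * Real.pi), ‖u n (circleMap 0 r θ)‖ₑ ^ 2) := by
            rw [← mul_assoc, mul_comm (ENNReal.ofReal _), hne, one_mul]
        _ ≤ ENNReal.ofReal (2 * Real.pi) * 1 := by gcongr
        _ = _ := mul_one _
    have := lintegral_enorm_sq_le_of_hasSum hv (c := c)
      (S := fun θ => ∑' n, c n * u n (circleMap 0 r θ))
      (.of_forall fun θ => (hu.summable hc (hcirc θ)).hasSum) hK
    calc _ ≤ ENNReal.ofReal (2 * Real.pi)⁻¹ *
          ((∑' n, ‖c n‖ₑ) ^ 2 * ENNReal.ofReal (2 * Real.pi)) := by gcongr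
      _ = _ := by rw [mul_left_comm, hne, mul_one]
  · have hPm := (measurable_poissonIntegral μ).ennreal_ofReal
    set ν := (volume.restrict (ball (0 : ℂ) 1)).withDensity
      (fun z => ENNReal.ofReal (poissonIntegral μ z)) with hν
    have hconv : ∀ f : ℂ → ℂ, dirichletIntegral μ f =
        ENNReal.ofReal (1 / Real.pi) * ∫⁻ z, ‖deriv f z‖ₑ ^ 2 ∂ν := by
      intro f
      rw [dirichletIntegral_eq, hν, lintegral_withDensity_eq_lintegral_mul _ hPm
        ((measurable_deriv f).enorm.pow_const 2)]
      simp only [Pi.mul_apply, mul_comm]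
    have hne : ENNReal.ofReal Real.pi * ENNReal.ofReal (1 / Real.pi) = 1 := by
      rw [← ENNReal.ofReal_mul (by positivity), mul_one_div_cancel hπ.ne', ENNReal.ofReal_one]
    have hK : ∀ n, ∫⁻ z, ‖deriv (u n) z‖ₑ ^ 2 ∂ν ≤ ENNReal.ofReal Real.pi * ENNReal.ofReal K := by
      intro n
      have h1 := hu.dirichlet n
      rw [hconv] at h1
      calc _ = ENNReal.ofReal Real.pi * (ENNReal.ofReal (1 / Real.pi) *
            ∫⁻ z, ‖deriv (u n) z‖ₑ ^ 2 ∂ν) := by rw [← mul_assoc, hne, one_mul]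
        _ ≤ _ := by gcongr
    have hae : ∀ᵐ z ∂ν, HasSum (fun n => c n * deriv (u n) z)
        (deriv (fun z => ∑' n, c n * u n z) z) :=
      (withDensity_absolutelyContinuous _ _).ae_le
        ((ae_restrict_mem measurableSet_ball).mono hder)
    have := lintegral_enorm_sq_le_of_hasSum (fun n => (measurable_deriv (u n)).aemeasurable) hae hK
    rw [hconv]
    refine ENNReal.mul_lt_top ENNReal.ofReal_lt_top (this.trans_lt ?_)
    finiteness

lemma norm_tsum_le (hu : UniformlyDirichlet μ u K) {c : ℕ → ℂ}
    (hc : Summable fun n => ‖c n‖) {z : ℂ} (hz : ‖z‖ < 1) :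
    ‖∑' n, c n * u n z‖ ≤ (∑' n, ‖c n‖) * (1 / (1 - ‖z‖)) := by
  rw [← tsum_mul_right]
  refine tsum_of_norm_bounded (hc.mul_right _).hasSum fun n => ?_
  rw [norm_mul]
  gcongr
  exact hu.bound n z hz

/-- Bounded sequences of the harmonically weighted Dirichlet space are bounded in `H(b)`, if the
former is contained in the latter: by the closed graph theorem the synthesis map from `ℓ¹` to
`H(b)` is bounded. -/
lemma exists_norm_le [IsFiniteMeasure μ] (hu : UniformlyDirichlet μ u K) {b : ℂ → ℂ}
    [Fact (dbrMatrix b).PosSemidef]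
    (hmem : ∀ f ∈ harmonicDirichlet μ, ∃ g : RKHS.OfKernel (dbrMatrix b), ∀ z : 𝔻, f z = g z) :
    ∃ C : ℝ, ∀ n, ∀ g : RKHS.OfKernel (dbrMatrix b), (∀ z : 𝔻, g z = u n z) → ‖g‖ ≤ C := by
  choose T hT using fun c : lp (fun _ : ℕ => ℂ) 1 => hmem _ (hu.tsum_mem (summable_lp_one c))
  let L : lp (fun _ : ℕ => ℂ) 1 →ₗ[ℂ] RKHS.OfKernel (dbrMatrix b) :=
    { toFun := T
      map_add' := fun x y => by
        refine RKHS.ext fun z => ?_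
        rw [RKHS.coe_add, Pi.add_apply, ← hT, ← hT, ← hT,
          ← (hu.summable (summable_lp_one x) z.norm_lt_one).tsum_add
            (hu.summable (summable_lp_one y) z.norm_lt_one)]
        simp only [lp.coeFn_add, Pi.add_apply, add_mul]
      map_smul' := fun a x => by
        refine RKHS.ext fun z => ?_
        rw [RKHS.coe_smul, Pi.smul_apply, ← hT, RingHom.id_apply, ← hT, smul_eq_mul,
          ← tsum_mul_left]
        simp only [lp.coeFn_smul, Pi.smul_apply, smul_eq_mul, mul_assoc] }
  have hcont : Continuous L := by
    refine LinearMap.continuous_of_seq_closed_graph (g := L) fun c x y hc hy => ?_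
    refine RKHS.ext fun z => ?_
    have h1 : Tendsto (fun j => L (c j) z) atTop (𝓝 (y z)) :=
      ((RKHS.continuous_eval z).tendsto y).comp hy
    have h2 : Tendsto (fun j => L (c j) z) atTop (𝓝 (L x z)) := by
      rw [tendsto_iff_norm_sub_tendsto_zero] at hc ⊢
      refine squeeze_zero (fun _ => norm_nonneg _) (fun j => ?_)
        (by simpa using hc.mul_const (1 / (1 - ‖(z : ℂ)‖)))
      have h3 : L (c j) z - L x z = L (c j - x) z := by
        rw [map_sub, RKHS.coe_sub, Pi.sub_apply]
      rw [h3, norm_lp_one]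
      change ‖T (c j - x) z‖ ≤ _
      rw [← hT]
      simpa using hu.norm_tsum_le (summable_lp_one (c j - x)) z.norm_lt_one
    exact tendsto_nhds_unique h1 h2
  let L' : lp (fun _ : ℕ => ℂ) 1 →L[ℂ] RKHS.OfKernel (dbrMatrix b) := ⟨L, hcont⟩
  refine ⟨‖L'‖, fun n g hg => ?_⟩
  have he : g = L' (lp.single 1 n (1 : ℂ)) := by
    refine RKHS.ext fun z => ?_
    change _ = T _ z
    rw [← hT, hg, tsum_eq_single n]
    · simp
    · intro m hm
      simp [hm]
  rw [he]
  refine (L'.le_opNorm _).trans ?_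
  rw [lp.norm_single (by norm_num)]
  simp

end UniformlyDirichlet

/-! ### Finiteness of the quadratic potential -/

lemma norm_circleExp_sub_le (s t : ℝ) :
    ‖(Circle.exp s : ℂ) - Circle.exp t‖ ≤ |s - t| := by
  have h := Real.norm_exp_I_mul_ofReal_sub_one_le (x := s - t)
  have e : (Circle.exp s : ℂ) - Circle.exp t
      = Circle.exp t * (exp (I * ((s - t : ℝ) : ℂ)) - 1) := by
    rw [mul_sub, mul_one, Circle.coe_exp, Circle.coe_exp, ← Complex.exp_add]
    congr 2
    push_cast
    ring
  rw [e, norm_mul, Circle.norm_coe, one_mul]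
  exact h

lemma measure_le_mul_quadraticPotential (μ : Measure Circle) {I : Set Circle} {ξ : Circle} {δ : ℝ}
    (hδ : 0 < δ) (hI : ∀ ζ ∈ I, ‖(ξ : ℂ) - ζ‖ ≤ δ) :
    μ I ≤ ENNReal.ofReal (δ ^ 2) * quadraticPotential μ ξ := by
  have h0 : ENNReal.ofReal (δ ^ 2) ≠ 0 := by simpa using by positivity
  have h1 := mul_meas_ge_le_lintegral (μ := μ) (measurable_quadraticKernel ξ)
    (ENNReal.ofReal (δ ^ 2))⁻¹
  have hsub : I ⊆ {ζ : Circle | (ENNReal.ofReal (δ ^ 2))⁻¹ ≤ (‖(ξ : ℂ) - ζ‖ₑ ^ 2)⁻¹} := by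
    intro ζ hζ
    simp only [mem_ofPred_eq]
    rw [ENNReal.inv_le_inv, ENNReal.ofReal_pow hδ.le, ← ofReal_norm]
    gcongr
    exact hI ζ hζ
  calc μ I = ENNReal.ofReal (δ ^ 2) * ((ENNReal.ofReal (δ ^ 2))⁻¹ * μ I) := by
        rw [← mul_assoc, ENNReal.mul_inv_cancel h0 ENNReal.ofReal_ne_top, one_mul]
    _ ≤ _ := by
        gcongr
        exact le_trans (by gcongr) h1

/-- A finite measure does not charge a set on which its quadratic potential is finite: if the
potential is at most `n` on a set that is cut into `N + 1` pieces of diameter `O(1 / N)`, then the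
pieces have total measure `O(n / N)`. -/
lemma measure_eq_zero_of_quadraticPotential_lt_top (μ : Measure Circle) {U : Set Circle}
    (h : ∀ ξ ∈ U, quadraticPotential μ ξ < ∞) : μ U = 0 := by
  have hU : U ⊆ ⋃ n : ℕ, {ξ : Circle | quadraticPotential μ ξ ≤ n} := by
    intro ξ hξ
    obtain ⟨n, hn⟩ := ENNReal.exists_nat_gt (h ξ hξ).ne
    exact mem_iUnion.mpr ⟨n, hn.le⟩
  refine measure_mono_null hU (measure_iUnion_null fun n => ?_)
  set E := {ξ : Circle | quadraticPotential μ ξ ≤ n} with hE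
  have hπ := Real.pi_pos
  have hN : ∀ N : ℕ, μ E ≤ ENNReal.ofReal (8 * Real.pi ^ 2 * n / (N + 1 : ℕ)) := by
    intro N'
    set N := N' + 1 with hNdef
    have hN0 : (0 : ℝ) < N := by positivity
    have hN1 : (1 : ℝ) ≤ N := by rw [hNdef]; push_cast; linarith [N'.cast_nonneg (α := ℝ)]
    set J : ℕ → Set Circle := fun j => Circle.exp ''
      Icc (-Real.pi + j * (2 * Real.pi / N)) (-Real.pi + (j + 1) * (2 * Real.pi / N)) with hJ
    have hcover : E ⊆ ⋃ j ∈ Finset.range (N + 1), E ∩ J j := by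
      intro ζ hζ
      set s := (arg ζ + Real.pi) / (2 * Real.pi / N) with hs
      have hd : 0 < 2 * Real.pi / N := by positivity
      have hs0 : 0 ≤ s := by
        have := neg_pi_lt_arg (ζ : ℂ)
        have : 0 ≤ arg ζ + Real.pi := by linarith
        positivity
      have hsN : s ≤ N := by
        rw [hs, div_le_iff₀ hd]
        have := arg_le_pi (ζ : ℂ)
        have e : (N : ℝ) * (2 * Real.pi / N) = 2 * Real.pi := by field_simp
        rw [e]; linarith
      have hsd : s * (2 * Real.pi / N) = arg ζ + Real.pi := div_mul_cancel₀ _ hd.ne'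
      have hfl := Nat.floor_le hs0
      have hfl2 := (Nat.lt_floor_add_one s).le
      refine mem_biUnion (x := ⌊s⌋₊) ?_ ⟨hζ, arg ζ, ⟨?_, ?_⟩, Circle.exp_arg ζ⟩
      · have h1 : (⌊s⌋₊ : ℝ) ≤ N := hfl.trans hsN
        have h2 : ⌊s⌋₊ ≤ N := by exact_mod_cast h1
        simpa using Nat.lt_succ_of_le h2
      · have := mul_le_mul_of_nonneg_right hfl hd.le
        linarith
      · have := mul_le_mul_of_nonneg_right hfl2 hd.le
        linarith
    have hpiece : ∀ j, μ (E ∩ J j) ≤ ENNReal.ofReal ((2 * Real.pi / N) ^ 2) * n := by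
      intro j
      rcases (E ∩ J j).eq_empty_or_nonempty with he | ⟨ξ, hξE, s, hs, rfl⟩
      · rw [he]; simp
      · refine (measure_mono inter_subset_right).trans
          ((measure_le_mul_quadraticPotential μ (ξ := Circle.exp s) (δ := 2 * Real.pi / N)
            (by positivity) ?_).trans (by gcongr; exact hξE))
        rintro _ ⟨t, ht, rfl⟩
        refine (norm_circleExp_sub_le s t).trans ?_
        rw [abs_le]
        constructor <;> linarith [hs.1, hs.2, ht.1, ht.2]
    calc μ E ≤ μ (⋃ j ∈ Finset.range (N + 1), E ∩ J j) := measure_mono hcover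
      _ ≤ ∑ j ∈ Finset.range (N + 1), μ (E ∩ J j) := measure_biUnion_finset_le _ _
      _ ≤ ∑ j ∈ Finset.range (N + 1), ENNReal.ofReal ((2 * Real.pi / N) ^ 2) * n :=
          Finset.sum_le_sum fun j _ => hpiece j
      _ = ENNReal.ofReal ((N + 1 : ℕ) * ((2 * Real.pi / N) ^ 2 * n)) := by
          rw [Finset.sum_const, Finset.card_range, nsmul_eq_mul,
            ENNReal.ofReal_mul (by positivity), ENNReal.ofReal_mul (by positivity),
            ENNReal.ofReal_natCast, ENNReal.ofReal_natCast]
      _ ≤ _ := by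
          apply ENNReal.ofReal_le_ofReal
          have e : ((N + 1 : ℕ) : ℝ) * ((2 * Real.pi / N) ^ 2 * n) =
            (N + 1) / N * (4 * Real.pi ^ 2 * n / N) := by
            push_cast; field_simp; ring
          have h2 : ((N : ℝ) + 1) / N ≤ 2 := by
            rw [div_le_iff₀ hN0]; linarith
          rw [e]
          calc _ ≤ 2 * (4 * Real.pi ^ 2 * n / N) := by gcongr
            _ = _ := by ring
  have hlim : Tendsto (fun N : ℕ => ENNReal.ofReal (8 * Real.pi ^ 2 * n / (N + 1 : ℕ))) atTop
      (𝓝 0) := by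
    have := (tendsto_const_div_atTop_nhds_zero_nat (8 * Real.pi ^ 2 * n)).comp
      (tendsto_add_atTop_nat 1)
    simpa using ENNReal.tendsto_ofReal this
  exact le_antisymm (ge_of_tendsto' hlim hN) zero_le

/-- Lower semicontinuity of the quadratic potential along sequences. -/
lemma quadraticPotential_le_of_tendsto {μ : Measure Circle} {w : ℕ → ℂ} {ξ : ℂ} {C : ℝ≥0∞}
    (hw : Tendsto w atTop (𝓝 ξ)) (hC : ∀ n, quadraticPotential μ (w n) ≤ C) :
    quadraticPotential μ ξ ≤ C := by
  calc quadraticPotential μ ξ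
      = ∫⁻ ζ : Circle, liminf (fun n => (‖w n - ζ‖ₑ ^ 2)⁻¹) atTop ∂μ := by
        refine lintegral_congr fun ζ => (Tendsto.liminf_eq ?_).symm
        have h1 : Tendsto (fun n => ‖w n - ζ‖ₑ) atTop (𝓝 ‖ξ - ζ‖ₑ) := (hw.sub_const _).enorm
        exact (((ENNReal.continuous_pow 2).tendsto _).comp h1).inv
    _ ≤ liminf (fun n => quadraticPotential μ (w n)) atTop :=
        lintegral_liminf_le fun n => measurable_quadraticKernel (w n)
    _ ≤ C := by
        refine liminf_le_of_le (by isBoundedDefault) fun c hc => ?_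
        obtain ⟨j, hj⟩ := hc.exists
        exact hj.trans (hC j)

/-! ### Lower bounds for the outer function -/

lemma norm_one_sub_conj_mul_circle {z ζ : ℂ} (hζ : ‖ζ‖ = 1) : ‖1 - conj z * ζ‖ = ‖ζ - z‖ := by
  have h1 : ζ * conj ζ = 1 := by
    rw [Complex.mul_conj, Complex.normSq_eq_norm_sq, hζ]; simp
  have e : 1 - conj z * ζ = ζ * conj (ζ - z) := by
    rw [map_sub, mul_sub, h1]; ring
  rw [e, norm_mul, norm_conj, hζ, one_mul]

lemma circleAverage_poissonKernel {z : ℂ} (hz : ‖z‖ < 1) :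
    Real.circleAverage (fun ζ => (1 - ‖z‖ ^ 2) / ‖ζ - z‖ ^ 2) 0 1 = 1 := by
  have h := one_sub_norm_sq_pos hz
  have h1 := Real.circleAverage_fun_smul (a := 1 - ‖z‖ ^ 2) (c := 0) (R := 1)
    (f := fun ζ => ‖szegoFun z ζ‖ ^ 2)
  rw [circleAverage_norm_sq_szegoFun hz, smul_eq_mul, mul_one_div_cancel h.ne'] at h1
  refine Eq.trans ?_ h1
  refine Real.circleAverage_congr_sphere fun ζ hζ => ?_
  have hζ1 : ‖ζ‖ = 1 := by simpa using hζ
  simp only [szegoFun, norm_div, norm_one, norm_one_sub_conj_mul_circle hζ1, smul_eq_mul]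
  rw [div_pow, one_pow, mul_one_div]

/-- If `|b|` stays away from `1` near `ξ`, then `|a|` is bounded below on an arc about `ξ`, and the
outer function `a` stays away from `0` along the radius of `ξ`. -/
lemma BoundaryData.not_hasRadialLimit_zero {b a : ℂ → ℂ} {k : ℂ → ℝ} (hd : BoundaryData b a k)
    {ξ : Circle} {ε c : ℝ} (hε : 0 < ε) (hc : 0 < c) (hc1 : c ≤ 1)
    (h : ∀ z : ℂ, ‖z‖ < 1 → ‖z - ξ‖ < ε → ‖b z‖ ^ 2 ≤ 1 - c) : ¬ HasRadialLimit a ξ 0 := by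
  intro hlim
  have hlog : Real.log c ≤ 0 := Real.log_nonpos hc.le hc1
  have harc : ∀ᵐ t : ℝ, ‖circleMap 0 1 t - ξ‖ < ε → Real.log c / 2 ≤ k (circleMap 0 1 t) := by
    filter_upwards [hd.limits] with t ⟨α, β, _, hβ, hs, hk⟩ hnear
    rw [circleMap_zero_one_eq] at hnear
    have hβle : ‖β‖ ^ 2 ≤ 1 - c := by
      refine le_of_tendsto (hβ.norm.pow 2) ?_
      have hcont : Tendsto (fun r : ℝ => ‖(r : ℂ) * Circle.exp t - ξ‖) (𝓝[<] 1)
          (𝓝 ‖(Circle.exp t : ℂ) - ξ‖) := by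
        have : Continuous fun r : ℝ => ‖(r : ℂ) * Circle.exp t - ξ‖ := by fun_prop
        have := this.tendsto 1
        simp only [ofReal_one, one_mul] at this
        exact this.mono_left nhdsWithin_le_nhds
      filter_upwards [hcont.eventually (gt_mem_nhds hnear),
        Ioo_mem_nhdsLT (zero_lt_one (α := ℝ))] with r hr1 hr2
      refine h _ ?_ hr1
      rw [norm_mul, Circle.norm_coe, mul_one, Complex.norm_real, Real.norm_of_nonneg hr2.1.le]
      exact hr2.2
    have hα : c ≤ ‖α‖ ^ 2 := by linarith
    rw [hk, ← Real.exp_nat_mul] at hα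
    have := (Real.log_le_iff_le_exp hc).mpr hα
    push_cast at this
    linarith
  -- With `P` the Poisson kernel at `r ξ`, one has `P k ≥ (log c / 2) P + (4 / ε²) k` on the circle:
  -- near `ξ` by the bound on `k`, and off `ξ` because `P ≤ 4 / ε²` there and `k ≤ 0`.
  set B : ℝ := Real.log c / 2 + 4 / ε ^ 2 * Real.circleAverage k 0 1 with hB
  have hev : ∀ᶠ r : ℝ in 𝓝[<] 1, Real.exp B ≤ ‖a (r * ξ)‖ := by
    have h1 : ∀ᶠ r : ℝ in 𝓝[<] 1, 1 - ε / 2 < r :=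
      mem_nhdsWithin_of_mem_nhds (lt_mem_nhds (by linarith))
    filter_upwards [h1, Ioo_mem_nhdsLT (zero_lt_one (α := ℝ))] with r hrε hr
    have hn : ‖(r : ℂ) * ξ‖ < 1 := by
      rw [norm_mul, Circle.norm_coe, mul_one, Complex.norm_real, Real.norm_of_nonneg hr.1.le]
      exact hr.2
    have hrξ : ‖(r : ℂ) * ξ - ξ‖ < ε / 2 := by
      have : (r : ℂ) * ξ - ξ = ((r - 1 : ℝ) : ℂ) * ξ := by push_cast; ring
      rw [this, norm_mul, Circle.norm_coe, mul_one, Complex.norm_real, Real.norm_eq_abs,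
        abs_sub_comm, abs_of_pos (by linarith [hr.2])]
      linarith
    set z : ℂ := (r : ℂ) * ξ with hz
    have hz1 := one_sub_norm_sq_pos hn
    have hPi : CircleIntegrable (fun ζ => (1 - ‖z‖ ^ 2) / ‖ζ - z‖ ^ 2) 0 1 := by
      simpa using circleIntegrable_poisson_mul (circleIntegrable_const (1 : ℝ) 0 1) hn
    rw [hd.norm_eq z hn, Real.exp_le_exp]
    have i1 : CircleIntegrable
        (fun ζ => (Real.log c / 2) • ((1 - ‖z‖ ^ 2) / ‖ζ - z‖ ^ 2)) 0 1 := hPi.const_smul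
    have i2 : CircleIntegrable (fun ζ => (4 / ε ^ 2) • k ζ) 0 1 := hd.integrable.const_smul
    have hBavg : B = Real.circleAverage (fun ζ =>
        (Real.log c / 2) • ((1 - ‖z‖ ^ 2) / ‖ζ - z‖ ^ 2) + (4 / ε ^ 2) • k ζ) 0 1 := by
      rw [Real.circleAverage_fun_add i1 i2, Real.circleAverage_fun_smul,
        Real.circleAverage_fun_smul, circleAverage_poissonKernel hn, hB]
      simp
    rw [hBavg]
    refine circleAverage_mono_ae (i1.add i2) (circleIntegrable_poisson_mul hd.integrable hn) ?_
    filter_upwards [harc, hd.log_nonpos] with t ht hk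
    set ζ := circleMap 0 1 t
    have hP : 0 ≤ (1 - ‖z‖ ^ 2) / ‖ζ - z‖ ^ 2 := by positivity
    simp only [smul_eq_mul]
    by_cases hnear : ‖ζ - ξ‖ < ε
    · have h2 := mul_le_mul_of_nonneg_left (ht hnear) hP
      have h3 : 4 / ε ^ 2 * k ζ ≤ 0 := mul_nonpos_of_nonneg_of_nonpos (by positivity) hk
      linarith
    · push Not at hnear
      have hfar : ε / 2 ≤ ‖ζ - z‖ := by
        have e : ζ - (ξ : ℂ) = (ζ - z) + (z - ξ) := by ring
        rw [e] at hnear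
        have := norm_add_le (ζ - z) (z - (ξ : ℂ))
        linarith
      have hPle : (1 - ‖z‖ ^ 2) / ‖ζ - z‖ ^ 2 ≤ 4 / ε ^ 2 := by
        calc (1 - ‖z‖ ^ 2) / ‖ζ - z‖ ^ 2 ≤ 1 / (ε / 2) ^ 2 := by
              gcongr
              linarith [sq_nonneg ‖z‖]
          _ = 4 / ε ^ 2 := by field_simp; norm_num
      have h2 := mul_le_mul_of_nonpos_right hPle hk
      have h3 : Real.log c / 2 * ((1 - ‖z‖ ^ 2) / ‖ζ - z‖ ^ 2) ≤ 0 :=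
        mul_nonpos_of_nonpos_of_nonneg (by linarith) hP
      linarith
  have := ge_of_tendsto hlim.norm hev
  rw [norm_zero] at this
  exact (Real.exp_pos B).not_ge this

/-! ### Comparison of the two spaces on Cauchy kernels -/

lemma circleAverage_norm_sq_szegoFun_radius {w : ℂ} (hw : ‖w‖ < 1) {r : ℝ}
    (hr : r ∈ Ioo (0 : ℝ) 1) :
    Real.circleAverage (fun z => ‖szegoFun w z‖ ^ 2) 0 r = 1 / (1 - ‖(r : ℂ) * w‖ ^ 2) := by
  have hrw : ‖(r : ℂ) * w‖ < 1 := by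
    have := mul_mem_ball_of_mem_closedBall hr (z := w) (by simpa using hw.le)
    simpa using this
  rw [Real.circleAverage_eq_circleAverage_zero_one, ← circleAverage_norm_sq_szegoFun hrw]
  congr 1
  funext ζ
  simp [szegoFun]
  ring_nf

lemma circleAverage_norm_sq_szegoFun_le {w : ℂ} (hw : ‖w‖ < 1) {r : ℝ}
    (hr : r ∈ Ioo (0 : ℝ) 1) :
    Real.circleAverage (fun z => ‖szegoFun w z‖ ^ 2) 0 r ≤ 1 / (1 - ‖w‖) := by
  rw [circleAverage_norm_sq_szegoFun_radius hw hr]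
  have h1 : ‖(r : ℂ) * w‖ ≤ ‖w‖ := by
    rw [norm_mul, Complex.norm_real, Real.norm_of_nonneg hr.1.le]
    exact mul_le_of_le_one_left (norm_nonneg _) hr.2.le
  have h2 : 0 < 1 - ‖w‖ := by linarith
  gcongr
  nlinarith [norm_nonneg w, norm_nonneg ((r : ℂ) * w)]

lemma differentiableOn_szegoFun {w : ℂ} (hw : ‖w‖ < 1) :
    DifferentiableOn ℂ (szegoFun w) (ball 0 1) :=
  (diffContOnCl_szegoFun hw).differentiableOn

lemma szegoFun_mem_harmonicDirichlet (μ : Measure Circle) [IsFiniteMeasure μ] {w : ℂ}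
    (hw : ‖w‖ < 1) : szegoFun w ∈ harmonicDirichlet μ :=
  ⟨⟨differentiableOn_szegoFun hw, _, fun _ hr => circleAverage_norm_sq_szegoFun_le hw hr⟩,
    dirichletIntegral_szegoFun_lt_top μ hw⟩

/-- The Cauchy kernel at `w`, scaled to have bounded `H²` norm. -/
def scaledSzego (w : ℂ) : ℂ → ℂ := ((√(1 - ‖w‖) : ℝ) : ℂ) • szegoFun w

lemma uniformlyDirichlet_scaledSzego {μ : Measure Circle} [IsFiniteMeasure μ] {w : ℕ → ℂ}
    (hw : ∀ n, ‖w n‖ < 1) {K : ℝ} (hK : ∀ n,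
      ENNReal.ofReal (1 - ‖w n‖) * dirichletIntegral μ (szegoFun (w n)) ≤ ENNReal.ofReal K) :
    UniformlyDirichlet μ (fun n => scaledSzego (w n)) K where
  diff n := (differentiableOn_szegoFun (hw n)).const_smul _
  bound n z hz := by
    have h1 := one_sub_norm_le_norm_one_sub' (z := z) (hw n).le
    have h2 : √(1 - ‖w n‖) ≤ 1 := by
      refine (Real.sqrt_le_sqrt ?_).trans_eq Real.sqrt_one
      linarith [norm_nonneg (w n)]
    have h3 : 0 < 1 - ‖z‖ := by linarith
    simp only [scaledSzego, Pi.smul_apply, norm_smul, Complex.norm_real,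
      Real.norm_of_nonneg (Real.sqrt_nonneg _), szegoFun, norm_div, norm_one]
    calc √(1 - ‖w n‖) * (1 / ‖1 - conj (w n) * z‖) ≤ 1 * (1 / (1 - ‖z‖)) := by gcongr
      _ = _ := one_mul _
  hardy n r hr := by
    have h0 : 0 < 1 - ‖w n‖ := by linarith [hw n]
    have h1 := Real.circleAverage_fun_smul (a := 1 - ‖w n‖) (c := 0) (R := r)
      (f := fun z => ‖szegoFun (w n) z‖ ^ 2)
    simp only [scaledSzego, Pi.smul_apply, norm_smul, Complex.norm_real,
      Real.norm_of_nonneg (Real.sqrt_nonneg _), mul_pow, Real.sq_sqrt h0.le]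
    simp only [smul_eq_mul] at h1
    rw [h1]
    have h2 := mul_le_mul_of_nonneg_left (circleAverage_norm_sq_szegoFun_le (hw n) hr) h0.le
    rwa [mul_one_div_cancel h0.ne'] at h2
  dirichlet n := by
    have h0 : 0 < 1 - ‖w n‖ := by linarith [hw n]
    rw [scaledSzego, dirichletIntegral_const_smul, ← ofReal_norm, Complex.norm_real,
      Real.norm_of_nonneg (Real.sqrt_nonneg _), ← ENNReal.ofReal_pow (Real.sqrt_nonneg _),
      Real.sq_sqrt h0.le]
    exact hK n

section Equality

variable {b a : ℂ → ℂ} [Fact (dbrMatrix b).PosSemidef] {μ : Measure Circle} [IsFiniteMeasure μ]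

/-- Off the support of `μ` the symbol `b` stays away from modulus `1`: otherwise the evaluations
on `H(b)` would be too small for the Cauchy kernels, which have bounded scaled Dirichlet norms. -/
lemma exists_norm_sq_le_of_notMem_support (hb : IsSchur b)
    (hmem : ∀ f ∈ harmonicDirichlet μ, ∃ g : RKHS.OfKernel (dbrMatrix b), ∀ z : 𝔻, f z = g z)
    {ξ : Circle} (hξ : ξ ∉ μ.support) :
    ∃ ε > 0, ∃ c > 0, c ≤ 1 ∧ ∀ z : ℂ, ‖z‖ < 1 → ‖z - ξ‖ < ε → ‖b z‖ ^ 2 ≤ 1 - c := by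
  obtain ⟨ε, hε, K, hK⟩ := exists_dirichletIntegral_szegoFun_le hξ
  have hbdd : ∃ C : ℝ, ∀ w : ℂ, ‖w‖ < 1 → ‖w - ξ‖ < ε → ∀ g : RKHS.OfKernel (dbrMatrix b),
      (∀ z : 𝔻, g z = scaledSzego w z) → ‖g‖ ≤ C := by
    by_contra! hcon
    choose w hw1 hw2 g hg hgn using fun n : ℕ => hcon n
    obtain ⟨C, hC⟩ := (uniformlyDirichlet_scaledSzego hw1
      fun n => hK (w n) (hw1 n) (hw2 n)).exists_norm_le hmem
    obtain ⟨n, hn⟩ := exists_nat_gt C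
    exact absurd (hC n (g n) (hg n)) (not_le.mpr (hn.trans (hgn n)))
  obtain ⟨C, hC⟩ := hbdd
  refine ⟨ε, hε, 1 / (2 * (C ^ 2 + 1)), by positivity, ?_, fun w hw1 hw2 => ?_⟩
  · rw [div_le_one (by positivity)]
    nlinarith [sq_nonneg C]
  · obtain ⟨g₀, hg₀⟩ := hmem _ (szegoFun_mem_harmonicDirichlet μ hw1)
    set g : RKHS.OfKernel (dbrMatrix b) := ((√(1 - ‖w‖) : ℝ) : ℂ) • g₀ with hg
    have hgz : ∀ z : 𝔻, g z = scaledSzego w z := fun z => by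
      rw [hg, RKHS.coe_smul, Pi.smul_apply, ← hg₀]
      rfl
    have hgC := hC w hw1 hw2 g hgz
    have hev := norm_sq_apply_le hb g (UnitDisc.mk w hw1)
    have h0 : 0 < 1 - ‖w‖ := by linarith
    have h1 := one_sub_norm_sq_pos hw1
    rw [hgz] at hev
    simp only [UnitDisc.coe_mk, scaledSzego, Pi.smul_apply, szegoFun_self, norm_smul,
      Complex.norm_real, Real.norm_of_nonneg (Real.sqrt_nonneg _), mul_pow,
      Real.sq_sqrt h0.le] at hev
    rw [Real.norm_of_nonneg (by positivity)] at hev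
    have hb1 : ‖b w‖ ^ 2 ≤ 1 := pow_le_one₀ (norm_nonneg _) (hb.bound w (by simpa using hw1))
    have hg2 : ‖g‖ ^ 2 ≤ C ^ 2 := pow_le_pow_left₀ (norm_nonneg _) hgC 2
    have h2 : (1 - ‖w‖) / (1 - ‖w‖ ^ 2) ≤ C ^ 2 * (1 - ‖b w‖ ^ 2) := by
      have h3 := mul_le_mul_of_nonneg_right hev h1.le
      calc (1 - ‖w‖) / (1 - ‖w‖ ^ 2)
          = (1 - ‖w‖) * (1 / (1 - ‖w‖ ^ 2)) ^ 2 * (1 - ‖w‖ ^ 2) := by field_simp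
        _ ≤ ‖g‖ ^ 2 * ((1 - ‖b w‖ ^ 2) / (1 - ‖w‖ ^ 2)) * (1 - ‖w‖ ^ 2) := h3
        _ = ‖g‖ ^ 2 * (1 - ‖b w‖ ^ 2) := by field_simp
        _ ≤ _ := by
            have : 0 ≤ 1 - ‖b w‖ ^ 2 := by linarith
            gcongr
    have h4 : 1 / 2 ≤ (1 - ‖w‖) / (1 - ‖w‖ ^ 2) := by
      rw [div_le_div_iff₀ two_pos h1]
      nlinarith [norm_nonneg w]
    have h5 : 1 / (2 * (C ^ 2 + 1)) ≤ 1 - ‖b w‖ ^ 2 := by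
      rw [div_le_iff₀ (by positivity)]
      nlinarith
    linarith

/-- At a point of the circle where `a` does not tend to zero radially, the quadratic potential of
`μ` is finite. -/
lemma quadraticPotential_lt_top {k : ℂ → ℝ} (hd : BoundaryData b a k) (hb : IsSchur b)
    (hmem : ∀ g : RKHS.OfKernel (dbrMatrix b), discExtend g ∈ harmonicDirichlet μ)
    (hmem' : ∀ f ∈ harmonicDirichlet μ, ∃ g : RKHS.OfKernel (dbrMatrix b), ∀ z : 𝔻, f z = g z)
    {ξ : Circle} (hξ : ¬ HasRadialLimit a ξ 0) : quadraticPotential μ ξ < ∞ := by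
  obtain ⟨C, hC⟩ := exists_dirichletIntegral_le hb hmem
  rw [HasRadialLimit, Metric.tendsto_nhds] at hξ
  push Not at hξ
  obtain ⟨η, hη, hfreq⟩ := hξ
  obtain ⟨r, hr, hrη⟩ := exists_seq_forall_of_frequently
    (hfreq.and_eventually (Ioo_mem_nhdsLT (show (1 / 2 : ℝ) < 1 by norm_num)))
  set D := max C 0 with hD
  have hD0 : 0 ≤ D := le_max_right _ _
  have hlim : Tendsto (fun n => (r n : ℂ) * ξ) atTop (𝓝 (ξ : ℂ)) := by
    have h1 : Tendsto r atTop (𝓝 1) := hr.mono_right nhdsWithin_le_nhds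
    have h2 := ((Complex.continuous_ofReal.tendsto 1).comp h1).mul_const (ξ : ℂ)
    simpa using h2
  refine (quadraticPotential_le_of_tendsto (C := ENNReal.ofReal (3000 * (D * (1 + 1 / η ^ 2))))
    hlim fun n => ?_).trans_lt ENNReal.ofReal_lt_top
  obtain ⟨hη2, hr1, hr2⟩ := hrη n
  have hn : ‖(r n : ℂ) * ξ‖ = r n := by
    rw [norm_mul, Circle.norm_coe, mul_one, Complex.norm_real, Real.norm_of_nonneg (by linarith)]
  set w : ℂ := (r n : ℂ) * ξ with hw
  have hw1 : ‖w‖ < 1 := by rw [hn]; exact hr2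
  have hw2 : 1 / 2 ≤ ‖w‖ := by rw [hn]; exact hr1.le
  obtain ⟨g, hg⟩ := hmem' _ (szegoFun_mem_harmonicDirichlet μ hw1)
  have hgn := norm_sq_le_of_eq_szegoFun hd hb (UnitDisc.mk w hw1) g fun z => (hg z).symm
  simp only [UnitDisc.coe_mk] at hgn
  have hb1 : ‖b w‖ ^ 2 ≤ 1 := pow_le_one₀ (norm_nonneg _) (hb.bound w (by simpa using hw1))
  rw [dist_zero_right] at hη2
  have hp := one_sub_norm_sq_pos hw1
  have h0 : 0 < 1 - ‖w‖ := by linarith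
  have hgn2 : ‖g‖ ^ 2 ≤ (1 + 1 / η ^ 2) / (1 - ‖w‖) := by
    refine hgn.trans ?_
    have : 1 - ‖w‖ ≤ 1 - ‖w‖ ^ 2 := by nlinarith [norm_nonneg w]
    gcongr
  have hDg : dirichletIntegral μ (szegoFun w) = dirichletIntegral μ (discExtend g) := by
    refine dirichletIntegral_congr μ fun z hz => ?_
    have hz1 : ‖z‖ < 1 := by simpa using hz
    rw [discExtend, dif_pos hz1, ← hg, UnitDisc.coe_mk]
  calc quadraticPotential μ w
      ≤ ENNReal.ofReal (3000 * (1 - ‖w‖)) * dirichletIntegral μ (szegoFun w) :=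
        quadraticPotential_le_dirichletIntegral μ hw1 hw2
    _ ≤ ENNReal.ofReal (3000 * (1 - ‖w‖)) *
        ENNReal.ofReal (D * ((1 + 1 / η ^ 2) / (1 - ‖w‖))) := by
        rw [hDg]
        gcongr
        refine (hC g).trans (ENNReal.ofReal_le_ofReal ?_)
        gcongr
        exact le_max_left _ _
    _ = _ := by
        rw [← ENNReal.ofReal_mul (by positivity)]
        congr 1
        field_simp

end Equality

end

theorem theorem5p3 (b a : ℂ → ℂ) (hba : IsCoronaPair b a)
    (μ : Measure Circle) [IsFiniteMeasure μ]
    (h : deBrangesRovnyak b hba.schur = harmonicDirichlet μ) :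
    μ.support = closure (boundaryZeroSet a) := by
  have : Fact (dbrMatrix b).PosSemidef := ⟨posSemidef_dbrMatrix hba.schur⟩
  obtain ⟨k, hd⟩ := hba.toIsPythagoreanPair.exists_boundaryData
  have hmem : ∀ g : RKHS.OfKernel (dbrMatrix b), discExtend g ∈ harmonicDirichlet μ := fun g => by
    rw [← h]
    exact ⟨g, fun z => discExtend_coe g z⟩
  have hmem' : ∀ f ∈ harmonicDirichlet μ, ∃ g : RKHS.OfKernel (dbrMatrix b), ∀ z : 𝔻, f z = g z :=
    fun f hf => by
      rw [← h] at hf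
      exact hf
  apply Subset.antisymm
  · intro ξ hξ
    by_contra hcl
    refine Measure.notMem_support_iff_exists.mpr
      ⟨(closure (boundaryZeroSet a))ᶜ, isClosed_closure.isOpen_compl.mem_nhds hcl, ?_⟩ hξ
    refine measure_eq_zero_of_quadraticPotential_lt_top μ fun ζ hζ => ?_
    exact quadraticPotential_lt_top hd hba.schur hmem hmem' fun hz => hζ (subset_closure hz)
  · refine closure_minimal (fun ξ hξ => ?_) Measure.isClosed_support
    by_contra hs
    obtain ⟨ε, hε, c, hc, hc1, hbc⟩ := exists_norm_sq_le_of_notMem_support hba.schur hmem' hs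
    exact hd.not_hasRadialLimit_zero hε hc hc1 hbc hξ
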